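/- **Theorem (Itô formula).** All Banach spaces are real. *Paths.* A path $X:[0,\infty)\to V$ in a Banach space $V$ is càdlàg if it is right continuous and has a left limit $X_{t-}$ at every $t>0$; $\Delta X_t=X_t-X_{t-}$ (with $X_{0-}=X_0$), $D(X)=\{t:\Delta X_t\neq 0\}$, $D_\varepsilon(X)=\{t:\|\Delta X_t\|\ge\varepsilon\}$ and $J_\varepsilon(X)_t=\sum_{0<s\le t}\Delta X_s 1_{D_\varepsilon(X)}(s)$. A path has finite variation if it has bounded variation on every compact interval; if it is also càdlàg, its continuous part is $A^{\mathrm c}_t=A_t-\sum_{0<s\le t}\Delta A_s$. *Partitions.* A partition of $[0,\infty)$ is a set $\pi=\{(t_i,t_{i+1}]: i\in\mathbb N\}$ with $0=t_0<t_1<\dots\to\infty$. For $t>0$ let $(\underline\pi(t),\overline\pi(t)]$ be its element containing $t$. Put $\delta X_t((r,s])=X_{s\wedge t}-X_{r\wedge t}$ and $O^+_t(X;\pi)=\sup_{(r,s]\in\pi}\ \sup_{u,v\in(r,s]\cap[0,t]}\|X_u-X_v\|$. A sequence $(\pi_n)$ of partitions - satisfies *Condition (C)* for $X$ if (C1) for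 all $t\ge0$ and $\varepsilon>0$ there is $N$ such that $I\cap[0,t]\cap D_\varepsilon(X)$ has at most one element for all $n\ge N$ and $I\in\pi_n$; (C2) for all $s\in D(X)$ and $t\ge s$, $\lim_n\{X(\overline{\pi_n}(s)\wedge t)-X(\underline{\pi_n}(s)\wedge t)\}=\Delta X_s$; (C3) for all $t\ge 0$, $\limsup_{\varepsilon\downarrow0}\limsup_{n\to\infty}O^+_t(X-J_\varepsilon(X);\pi_n)=0$; - *approximates $X$ from the left* if $X(\underline{\pi_n}(t))\to X_{t-}$ for all $t>0$. *Variations.* $X$ has finite 2-variation along $(\pi_n)$ if $\sup_n\sum_{I\in\pi_n}\|\delta X_t(I)\|^2<\infty$ for all $t$. For a bounded bilinear $B:E\times E\to E_1$, a càdlàg path $Q_B(X,X)$ of finite variation in $E_1$ is the weak (resp. strong) $B$-quadratic variation of the $E$-valued path $X$ along $(\pi_n)$ if, for all $t$, $\sum_{I\in\pi_n}B(\delta X_t(I),\delta X_t(I))\to Q_B(X,X)_t$ in the weak (resp. norm) topology and $\Delta Q_B(X,X)_t=B(\Delta X_t,\Delta X_t)$. *Operators and integrals.* $\mathcal L_{\mathrm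 c}(V,W)$ is the space of bounded linear maps $V\to W$ with the locally convex topology generated by the seminorms $\rho_K(T)=\inf\{C>0:\|Tx\|\le C\|x\|\ \forall x\in K\}$, $K\subset V$ compact. For a càglàd (left continuous with right limits) path $g$ in $\mathcal L_{\mathrm c}(V,W)$ and a càdlàg path $A$ of finite variation in $V$, $\int_0^t g(s)\,\mathrm dA_s\in W$ is the integral over $(0,t]$ obtained from $\int_0^t 1_{(a,b]}T\,\mathrm dA=T(A_{b\wedge t}-A_{a\wedge t})$ by linearity and continuous extension with respect to uniform convergence on compacts in $\mathcal L_{\mathrm c}(V,W)$. The sum $\sum_{0<s\le t}$ is the limit of the net of finite partial sums. A function $h:V\to W$ is Gâteaux differentiable at $x$ with derivative $Dh(x)\in\mathcal L(V,W)$ if $\frac1s\{h(x+sv)-h(x)\}\to Dh(x)v$ in norm as $s\to0$ for every $v\in V$; $h$ is twice Gâteaux differentiable if $h$ and $Dh:V\to\mathcal L(V,W)$ (operator norm) are Gâteaux differentiable. *Statement.* Let $E,E_1,F,G$ be Banach spaces, $B:E\times E\to E_1$ a bounded bilinear map, $(A,X)$ a càdlàg path in $F\times E$, and $(\pi_n)$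 a sequence of partitions of $[0,\infty)$ that satisfies Condition (C) for $(A,X)$ and approximates $(A,X)$ from the left. Suppose that $X$ has weak $B$-quadratic variation $Q_B(X,X)$ and finite 2-variation along $(\pi_n)$, and that $A$ has finite variation. Let $f:F\times E\to G$ be such that 1. $a\mapsto f(a,x)$ is Gâteaux differentiable for all $x\in E$, and $D_af:F\times E\to\mathcal L_{\mathrm c}(F,G)$ is continuous; 2. $x\mapsto f(a,x)$ is twice Gâteaux differentiable for all $a\in F$, and $D_xf:F\times E\to\mathcal L_{\mathrm c}(E,G)$ is continuous; 3. there is a continuous $D_B^2f:F\times E\to\mathcal L_{\mathrm c}(E_1,G)$ with $D_x^2f(a,x)(h,k)=D_B^2f(a,x)\,B(h,k)$ for all $(a,x)\in F\times E$ and $h,k\in E$. Then for every $t\ge0$ the Itô–Föllmer integral $$\int_0^tD_xf(A_{s-},X_{s-})\,\mathrm dX_s=\lim_{n\to\infty}\sum_{(r,s]\in\pi_n}D_xf(A_r,X_r)(X_{s\wedge t}-X_{r\wedge t})$$ exists as a limit in the weak topology of $G$, the other integrals and the sum below exist, and in $G$ $$\begin{aligned}f(A_t,X_t)-f(A_0,X_0)={}&\int_0^tD_af(A_{s-},X_{s-})\,\mathrm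 dA^{\mathrm c}_s+\int_0^tD_xf(A_{s-},X_{s-})\,\mathrm dX_s+\frac12\int_0^tD_B^2f(A_{s-},X_{s-})\,\mathrm dQ_B(X,X)^{\mathrm c}_s\\&+\sum_{0<s\le t}\bigl\{f(A_s,X_s)-f(A_{s-},X_{s-})-D_xf(A_{s-},X_{s-})\Delta X_s\bigr\}.\end{aligned}$$ If moreover $Q_B(X,X)$ is the strong $B$-quadratic variation of $X$, then the limit defining the Itô–Föllmer integral holds in the norm topology of $G$. -/

import Mathlib

open Set Filter Topology
open scoped NNReal ENNReal

noncomputable section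

namespace ItoFollmer

/-! ### Paths on the half line -/

/-- A càdlàg path on `[0, ∞)`: right continuous everywhere, with left limits at every `t > 0`. -/
def IsCadlag {E : Type*} [TopologicalSpace E] (X : ℝ≥0 → E) : Prop :=
  (∀ t, Tendsto X (𝓝[>] t) (𝓝 (X t))) ∧ ∀ t, 0 < t → ∃ l, Tendsto X (𝓝[<] t) (𝓝 l)

/-- The left limit `X(t-)`; by convention `X(0-) = X(0)`. -/
def leftVal {E : Type*} [TopologicalSpace E] (X : ℝ≥0 → E) (t : ℝ≥0) : E :=
  Function.leftLim X t

/-- The jump `ΔX(t) = X(t) - X(t-)`; in particular `ΔX(0) = 0`. -/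
def jump {E : Type*} [NormedAddCommGroup E] (X : ℝ≥0 → E) (t : ℝ≥0) : E :=
  X t - leftVal X t

/-- `D(X)`, the set of jump times. -/
def jumpSet {E : Type*} [NormedAddCommGroup E] (X : ℝ≥0 → E) : Set ℝ≥0 :=
  {t | ‖jump X t‖ ≠ 0}

/-- `D_ε(X)`, the set of times of jumps of norm at least `ε`. -/
def largeJumpSet {E : Type*} [NormedAddCommGroup E] (ε : ℝ) (X : ℝ≥0 → E) : Set ℝ≥0 :=
  {t | ε ≤ ‖jump X t‖}

/-- `J_ε(X)_t`, the sum of the jumps of norm at least `ε` in `(0, t]`; for a càdlàg path and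
`ε > 0` there are finitely many of them. -/
def largeJumpPart {E : Type*} [NormedAddCommGroup E] (ε : ℝ) (X : ℝ≥0 → E) (t : ℝ≥0) : E :=
  ∑ᶠ s ∈ Ioc 0 t ∩ largeJumpSet ε X, jump X s

/-- The continuous part `A^c_t = A_t - ∑_{0 < s ≤ t} ΔA_s` of a càdlàg path of finite variation
(the jumps of such a path in `(0, t]` are absolutely summable). -/
def contPart {E : Type*} [NormedAddCommGroup E] (A : ℝ≥0 → E) (t : ℝ≥0) : E :=
  A t - ∑' s : Ioc (0 : ℝ≥0) t, jump A s

/-! ### Partitions of the half line -/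

/-- A partition `{(t_i, t_{i+1}] : i ∈ ℕ}` of the half line, `0 = t_0 < t_1 < ⋯ → ∞`. -/
structure HalfLinePartition where
  pt : ℕ → ℝ≥0
  pt_zero : pt 0 = 0
  strictMono : StrictMono pt
  tendsto_atTop : Tendsto pt atTop atTop

namespace HalfLinePartition

/-- For `t > 0`, the index `i` such that `t ∈ (t_i, t_{i+1}]`. -/
def idx (π : HalfLinePartition) (t : ℝ≥0) : ℕ := sInf {i | t ≤ π.pt (i + 1)}

/-- The left end point of the element of the partition that contains `t > 0`. -/
def lower (π : HalfLinePartition) (t : ℝ≥0) : ℝ≥0 := π.pt (π.idx t)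

/-- The right end point of the element of the partition that contains `t > 0`. -/
def upper (π : HalfLinePartition) (t : ℝ≥0) : ℝ≥0 := π.pt (π.idx t + 1)

theorem mem_Ioc_lower_upper (π : HalfLinePartition) {t : ℝ≥0} (ht : 0 < t) :
    t ∈ Ioc (π.lower t) (π.upper t) := by
  have hne : {i | t ≤ π.pt (i + 1)}.Nonempty := by
    obtain ⟨i, hi⟩ := ((tendsto_add_atTop_iff_nat 1).2 π.tendsto_atTop |>.eventually_ge_atTop t).exists
    exact ⟨i, hi⟩
  refine ⟨?_, Nat.sInf_mem hne⟩
  unfold lower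
  rcases h : π.idx t with _ | k
  · rw [π.pt_zero]; exact ht
  · have : k ∉ {i | t ≤ π.pt (i + 1)} := Nat.notMem_of_lt_sInf (by
      change k < π.idx t
      omega)
    exact not_le.1 this

end HalfLinePartition

/-- The increment `δX_t((t_i, t_{i+1}]) = X(t_{i+1} ∧ t) - X(t_i ∧ t)`. It vanishes as soon as
`t ≤ t_i`, so that every sum over the elements of a partition below is a finite sum. -/
def incr {E : Type*} [NormedAddCommGroup E] (X : ℝ≥0 → E) (π : HalfLinePartition) (t : ℝ≥0)
    (i : ℕ) : E :=
  X (min (π.pt (i + 1)) t) - X (min (π.pt i) t)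

theorem incr_eq_zero {E : Type*} [NormedAddCommGroup E] (X : ℝ≥0 → E) (π : HalfLinePartition)
    {t : ℝ≥0} {i : ℕ} (h : t ≤ π.pt i) : incr X π t i = 0 := by
  have h' : t ≤ π.pt (i + 1) := h.trans (π.strictMono (Nat.lt_succ_self i)).le
  simp [incr, min_eq_right h, min_eq_right h']

theorem finite_pt_lt (π : HalfLinePartition) (t : ℝ≥0) : {i | π.pt i < t}.Finite := by
  obtain ⟨N, hN⟩ := eventually_atTop.1 (π.tendsto_atTop.eventually_ge_atTop t)
  exact (finite_lt_nat N).subset fun i hi => not_le.1 fun h => (hN i h).not_gt hi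

/-- `O⁺_t(X; π)`, the supremum over the elements `(r, s]` of the partition of the oscillation of
`X` on `(r, s] ∩ [0, t]`. -/
def oscPlus {E : Type*} [NormedAddCommGroup E] (X : ℝ≥0 → E) (π : HalfLinePartition) (t : ℝ≥0) :
    ℝ≥0∞ :=
  ⨆ i, Metric.ediam (X '' (Ioc (π.pt i) (π.pt (i + 1)) ∩ Iic t))

/-- Condition (C) of a sequence of partitions for a path. -/
structure ConditionC {E : Type*} [NormedAddCommGroup E] (X : ℝ≥0 → E)
    (π : ℕ → HalfLinePartition) : Prop where
  c1 : ∀ (t : ℝ≥0) (ε : ℝ), 0 < ε → ∃ N, ∀ n ≥ N, ∀ i,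
    (Ioc ((π n).pt i) ((π n).pt (i + 1)) ∩ Iic t ∩ largeJumpSet ε X).Subsingleton
  c2 : ∀ s ∈ jumpSet X, ∀ t, s ≤ t →
    Tendsto (fun n => X (min ((π n).upper s) t) - X (min ((π n).lower s) t)) atTop
      (𝓝 (jump X s))
  c3 : ∀ t, limsup (fun ε : ℝ =>
    limsup (fun n => oscPlus (fun u => X u - largeJumpPart ε X u) (π n) t) atTop) (𝓝[>] 0) = 0

/-- The sequence of partitions approximates the path from the left. -/
def ApproximatesFromLeft {E : Type*} [TopologicalSpace E] (π : ℕ → HalfLinePartition)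
    (X : ℝ≥0 → E) : Prop :=
  ∀ t, 0 < t → Tendsto (fun n => X ((π n).lower t)) atTop (𝓝 (leftVal X t))

/-- Finite 2-variation along a sequence of partitions:
`sup_n ∑_{I ∈ π_n} ‖δX_t(I)‖² < ∞` for all `t`. -/
def HasFiniteTwoVariation {E : Type*} [NormedAddCommGroup E] (X : ℝ≥0 → E)
    (π : ℕ → HalfLinePartition) : Prop :=
  ∀ t, ⨆ n, ∑' i, ‖incr X (π n) t i‖ₑ ^ 2 < ∞

/-- Weak convergence of a sequence in a normed space. -/
def WeakTendsto {G : Type*} [NormedAddCommGroup G] [NormedSpace ℝ G] (u : ℕ → G) (z : G) : Prop :=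
  Tendsto (fun n => toWeakSpace ℝ G (u n)) atTop (𝓝 (toWeakSpace ℝ G z))

section QuadVar

variable {E E₁ : Type*} [NormedAddCommGroup E] [NormedSpace ℝ E]
  [NormedAddCommGroup E₁] [NormedSpace ℝ E₁]

/-- The discrete quadratic variation `∑_{I ∈ π} B(δX_t, δX_t)(I)`. -/
def discreteQuadVar (B : E →L[ℝ] E →L[ℝ] E₁) (X : ℝ≥0 → E) (π : HalfLinePartition) (t : ℝ≥0) :
    E₁ :=
  ∑ᶠ i, B (incr X π t i) (incr X π t i)

/-- `Q` is the strong `B`-quadratic variation of `X` along the sequence of partitions. -/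
structure HasStrongQuadVar (B : E →L[ℝ] E →L[ℝ] E₁) (X : ℝ≥0 → E) (π : ℕ → HalfLinePartition)
    (Q : ℝ≥0 → E₁) : Prop where
  cadlag : IsCadlag Q
  finiteVariation : LocallyBoundedVariationOn Q univ
  tendsto : ∀ t, Tendsto (fun n => discreteQuadVar B X (π n) t) atTop (𝓝 (Q t))
  jump_eq : ∀ t, jump Q t = B (jump X t) (jump X t)

/-- `Q` is the weak `B`-quadratic variation of `X` along the sequence of partitions. -/
structure HasWeakQuadVar (B : E →L[ℝ] E →L[ℝ] E₁) (X : ℝ≥0 → E) (π : ℕ → HalfLinePartition)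
    (Q : ℝ≥0 → E₁) : Prop where
  cadlag : IsCadlag Q
  finiteVariation : LocallyBoundedVariationOn Q univ
  tendsto : ∀ t, WeakTendsto (fun n => discreteQuadVar B X (π n) t) (Q t)
  jump_eq : ∀ t, jump Q t = B (jump X t) (jump X t)

end QuadVar

section Operators

variable {E G : Type*} [NormedAddCommGroup E] [NormedSpace ℝ E]
  [NormedAddCommGroup G] [NormedSpace ℝ G]

/-! ### The space `L_c(E, G)` -/

/-- `ρ_K(T) = inf {C > 0 | ∀ x ∈ K, ‖T x‖ ≤ C ‖x‖}`. -/
def rho (K : Set E) (T : E →L[ℝ] G) : ℝ := sInf {C : ℝ | 0 < C ∧ ∀ x ∈ K, ‖T x‖ ≤ C * ‖x‖}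

theorem rho_nonneg (K : Set E) (T : E →L[ℝ] G) : 0 ≤ rho K T :=
  Real.sInf_nonneg fun _ h => h.1.le

theorem norm_apply_le_rho {K : Set E} (T : E →L[ℝ] G) {x : E} (hx : x ∈ K) :
    ‖T x‖ ≤ rho K T * ‖x‖ := by
  rcases (norm_nonneg x).eq_or_lt with h | h
  · have : x = 0 := norm_eq_zero.1 h.symm
    simp [this]
  · rw [← div_le_iff₀ h]
    refine le_csInf ⟨‖T‖ + 1, by positivity, fun y _ => ?_⟩ fun C hC => ?_
    · exact (T.le_opNorm y).trans
        (mul_le_mul_of_nonneg_right (by linarith) (norm_nonneg y))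
    · rw [div_le_iff₀ h]; exact hC.2 x hx

theorem rho_le {K : Set E} {T : E →L[ℝ] G} {C : ℝ} (hC : 0 ≤ C)
    (h : ∀ x ∈ K, ‖T x‖ ≤ C * ‖x‖) : rho K T ≤ C := by
  refine le_of_forall_pos_le_add fun ε hε => csInf_le ⟨0, fun _ h => h.1.le⟩ ?_
  exact ⟨by linarith, fun x hx => (h x hx).trans
    (mul_le_mul_of_nonneg_right (by linarith) (norm_nonneg x))⟩

theorem rho_mono {K K' : Set E} (h : K ⊆ K') (T : E →L[ℝ] G) : rho K T ≤ rho K' T :=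
  rho_le (rho_nonneg _ _) fun _ hx => norm_apply_le_rho T (h hx)

variable (G) in
/-- `ρ_K` as a seminorm on the space of bounded operators. -/
def rhoSeminorm (K : Set E) : Seminorm ℝ (E →L[ℝ] G) :=
  Seminorm.ofSMulLE (rho K)
    (le_antisymm (rho_le le_rfl (by simp)) (rho_nonneg _ _))
    (fun S T => rho_le (add_nonneg (rho_nonneg _ _) (rho_nonneg _ _)) fun x hx => by
      rw [add_mul]
      exact (norm_add_le _ _).trans
        (add_le_add (norm_apply_le_rho S hx) (norm_apply_le_rho T hx)))
    (fun c T => rho_le (mul_nonneg (norm_nonneg _) (rho_nonneg _ _)) fun x hx => by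
      rw [smul_apply, norm_smul, mul_assoc]
      exact mul_le_mul_of_nonneg_left (norm_apply_le_rho T hx) (norm_nonneg _))

variable (E G) in
/-- The topology of `L_c(E, G)`: the locally convex topology on the bounded operators generated by
the seminorms `ρ_K`, `K` a compact subset of `E`. -/
@[reducible] def lcTopology : TopologicalSpace (E →L[ℝ] G) :=
  SeminormFamily.moduleFilterBasis (𝕜 := ℝ)
    (fun K : {K : Set E // IsCompact K} => rhoSeminorm G K.1) |>.topology

/-- Continuity of a map into `L_c(E, G)`. -/
def LcContinuous {Z : Type*} [TopologicalSpace Z] (φ : Z → E →L[ℝ] G) : Prop :=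
  @Continuous Z (E →L[ℝ] G) _ (lcTopology E G) φ

theorem lcContinuous_iff {Z : Type*} [TopologicalSpace Z] (φ : Z → E →L[ℝ] G) :
    LcContinuous φ ↔ ∀ z₀, ∀ K : Set E, IsCompact K → ∀ ε > 0,
      ∀ᶠ z in 𝓝 z₀, rho K (φ z - φ z₀) < ε := by
  let _ := lcTopology E G
  have hp : WithSeminorms (𝕜 := ℝ) (E := E →L[ℝ] G)
      (fun K : {K : Set E // IsCompact K} => rhoSeminorm G K.1) := ⟨rfl⟩
  unfold LcContinuous
  rw [continuous_iff_continuousAt]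
  refine forall_congr' fun z₀ => ?_
  rw [ContinuousAt, hp.tendsto_nhds]
  exact ⟨fun h K hK => h ⟨K, hK⟩, fun h K => h K.1 K.2⟩

/-! ### Derivatives and integrals -/

/-- `L` is the Gâteaux derivative of `f` at `x`: for every `h`,
`(f (x + s h) - f x) / s → L h` in norm as `s → 0`, `s ≠ 0`. -/
def HasGateauxDerivAt (f : E → G) (L : E →L[ℝ] G) (x : E) : Prop :=
  ∀ h, Tendsto (fun s : ℝ => s⁻¹ • (f (x + s • h) - f x)) (𝓝[≠] 0) (𝓝 (L h))

variable (E G) in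
/-- A simple function `∑_j 1_{(l_j, r_j]} a_j` with pairwise disjoint intervals and values in the
bounded operators. -/
structure StepFun where
  n : ℕ
  left : Fin n → ℝ≥0
  right : Fin n → ℝ≥0
  left_le_right : ∀ j, left j ≤ right j
  disjoint : Pairwise fun j k => Disjoint (Ioc (left j) (right j)) (Ioc (left k) (right k))
  val : Fin n → E →L[ℝ] G

/-- The value of a simple function at a point. -/
def StepFun.eval (h : StepFun E G) (s : ℝ≥0) : E →L[ℝ] G :=
  ∑ j, (Ioc (h.left j) (h.right j)).indicator (fun _ => h.val j) s

/-- The integral over `(0, t]` of a simple function with respect to a path. -/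
def StepFun.integral (h : StepFun E G) (A : ℝ≥0 → E) (t : ℝ≥0) : G :=
  ∑ j, h.val j (A (min (h.right j) t) - A (min (h.left j) t))

/-- `z` is the Stieltjes integral `∫_{(0,t]} g(s) dA(s)`, where `g` is a càglàd path in `L_c(E, G)`
and `A` is a càdlàg path of finite variation: the value at `g` of the continuous extension of the
integral of simple functions with respect to uniform convergence on `(0, t]` in `L_c(E, G)`. That
is, `g` is a limit of simple functions, and the integrals of simple functions tend to `z` as the
functions tend to `g`. -/
structure HasStieltjesIntegral (g : ℝ≥0 → E →L[ℝ] G) (A : ℝ≥0 → E) (t : ℝ≥0) (z : G) : Prop where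
  approx : ∀ K : Set E, IsCompact K → ∀ δ > 0, ∃ h : StepFun E G,
    ∀ s ∈ Ioc 0 t, rho K (h.eval s - g s) < δ
  tendsto : ∀ ε > 0, ∃ K : Set E, IsCompact K ∧ ∃ δ > 0, ∀ h : StepFun E G,
    (∀ s ∈ Ioc 0 t, rho K (h.eval s - g s) < δ) → ‖h.integral A t - z‖ < ε

theorem HasStieltjesIntegral.unique {g : ℝ≥0 → E →L[ℝ] G} {A : ℝ≥0 → E} {t : ℝ≥0} {z w : G}
    (hz : HasStieltjesIntegral g A t z) (hw : HasStieltjesIntegral g A t w) : z = w := by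
  refine eq_of_norm_sub_le_zero (le_of_forall_pos_le_add fun ε hε => ?_)
  obtain ⟨K, hK, δ, hδ, h1⟩ := hz.tendsto (ε / 2) (half_pos hε)
  obtain ⟨K', hK', δ', hδ', h2⟩ := hw.tendsto (ε / 2) (half_pos hε)
  obtain ⟨h, hh⟩ := hz.approx (K ∪ K') (hK.union hK') (min δ δ') (lt_min hδ hδ')
  have e1 := h1 h fun s hs => (rho_mono subset_union_left _).trans_lt
    ((hh s hs).trans_le (min_le_left _ _))
  have e2 := h2 h fun s hs => (rho_mono subset_union_right _).trans_lt
    ((hh s hs).trans_le (min_le_right _ _))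
  have e3 : z - w = (h.integral A t - w) - (h.integral A t - z) := by abel
  rw [e3]
  linarith [norm_sub_le (h.integral A t - w) (h.integral A t - z)]

/-- The left-side Riemann sum `∑_{(r,s] ∈ π} H_r (X_{s ∧ t} - X_{r ∧ t})`. -/
def leftRiemannSum (H : ℝ≥0 → E →L[ℝ] G) (X : ℝ≥0 → E) (π : HalfLinePartition) (t : ℝ≥0) : G :=
  ∑ᶠ i, H (π.pt i) (incr X π t i)

/-- `z` is the strong Itô–Föllmer integral `∫_0^t H_{s-} dX_s` along the sequence. -/
def HasItoFollmerIntegral (H : ℝ≥0 → E →L[ℝ] G) (X : ℝ≥0 → E) (π : ℕ → HalfLinePartition)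
    (t : ℝ≥0) (z : G) : Prop :=
  Tendsto (fun n => leftRiemannSum H X (π n) t) atTop (𝓝 z)

/-- `z` is the weak Itô–Föllmer integral `∫_0^t H_{s-} dX_s` along the sequence. -/
def HasWeakItoFollmerIntegral (H : ℝ≥0 → E →L[ℝ] G) (X : ℝ≥0 → E) (π : ℕ → HalfLinePartition)
    (t : ℝ≥0) (z : G) : Prop :=
  WeakTendsto (fun n => leftRiemannSum H X (π n) t) z

end Operators

end ItoFollmer

end

/-!
The proof compares the telescoping sum `f(Z_t) - f(Z_0) = ∑ (f(Z_{t_{i+1} ∧ t}) - f(Z_{t_i ∧ t}))`,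
`Z = (A, X)`, with the left Riemann sums of `D_x f(Z) dX`. Expanding `f` to first order in `a` and
to second order in `x`, the difference is the sum of three terms: the weighted sum of `D_a f(Z)`
against the increments of `A`, half the weighted sum of `D_B² f(Z)` against the squares
`B(δX, δX)`, and the Taylor remainders.

*Continuity in `L_c`.* A convergent sequence of operators in `L_c` converges in operator norm
(`LcContinuous.continuous`), so on the metric space `F × E` the derivatives are norm continuous.
The seminorms `ρ_K` enter again only through the definition of the Stieltjes integral.

*Weighted sums.* `tendsto_weighted_sum` shows that both weighted sums tend to the Stieltjes
integrals of the left limits with respect to `A` and `Q`, in norm for `A`, and for `Q` weakly or in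
norm according to the convergence of the discrete quadratic variation. The integrand is replaced by
a simple function whose break points are *regular*, which means that `Z` at the right end point of
the partition element containing `p` tends to `Z_p`. At regular points the sums over whole elements
have the expected limit: the squares cut off at `p` and not cut off at `p` both contribute
`B(ΔX_p, ΔX_p)`. The partitions need not have vanishing mesh, so not every point is regular.
However, a point that is not regular lies in infinitely many elements together with some later jump
time `s`, and then `Z_-` is constant between the two (`exists_const_of_not_isRegularPoint`), so that
a break point can be moved to `s` (`exists_regular_cells`).

*Remainders.* The Taylor remainder between `z` and `w` is
`o(‖w.1 - z.1‖ + ‖w.2 - z.2‖²)` uniformly near compact sets, and these weights have bounded sums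
since `A` has finite variation and `X` has finite 2-variation. By Condition (C) the elements without
large jumps have small increments and contribute little, and each of the others contains one large
jump, so the sums of the remainders tend in norm to the sum over the jumps (`exists_hasSum_jump`).

*Conclusion.* The jump remainders are the jump terms of the formula less `D_a f(Z_-) ΔA` and
`(1/2) D_B² f(Z_-) ΔQ`; these are the jump parts of the two integrals
(`HasStieltjesIntegral.contPart`), and what is left are the integrals with respect to the
continuous parts.
-/

namespace ItoFollmer

/-! ### Càdlàg paths -/

section Paths

variable {E : Type*} [NormedAddCommGroup E] {X : ℝ≥0 → E}

theorem IsCadlag.tendsto_leftVal (h : IsCadlag X) (t : ℝ≥0) :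
    Tendsto X (𝓝[<] t) (𝓝 (leftVal X t)) := by
  refine tendsto_leftLim_of_tendsto ?_
  rcases eq_or_lt_of_le (zero_le : 0 ≤ t) with rfl | ht
  · exact ⟨0, by simp⟩
  · exact h.2 t ht

theorem IsCadlag.leftVal_tendsto_left (h : IsCadlag X) (t : ℝ≥0) :
    Tendsto (leftVal X) (𝓝[<] t) (𝓝 (leftVal X t)) :=
  (continuousWithinAt_leftLim_Iic (h.tendsto_leftVal t)).mono_left
    (nhdsWithin_mono _ Iio_subset_Iic_self)

/-- The path of left limits of a càdlàg path is càglàd, with the path itself as its right limits. -/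
theorem IsCadlag.leftVal_tendsto_right (h : IsCadlag X) (t : ℝ≥0) :
    Tendsto (leftVal X) (𝓝[>] t) (𝓝 (X t)) := by
  refine (closed_nhds_basis (X t)).tendsto_right_iff.2 ?_
  rintro s ⟨s_mem, s_closed⟩
  obtain ⟨u, tu, hu⟩ : ∃ u, t < u ∧ Ioo t u ⊆ {x | X x ∈ s} := by
    have := (closed_nhds_basis (X t)).tendsto_right_iff.1 (h.1 t) s ⟨s_mem, s_closed⟩
    simpa using (mem_nhdsGT_iff_exists_Ioo_subset).1 this
  filter_upwards [Ioo_mem_nhdsGT tu] with c hc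
  have : (𝓝[<] c).NeBot := nhdsLT_neBot_of_exists_lt ⟨t, hc.1⟩
  apply s_closed.mem_of_tendsto (h.tendsto_leftVal c)
  filter_upwards [Ioo_mem_nhdsLT_of_mem ⟨hc.1, hc.2.le⟩] with d hd using hu hd

theorem leftVal_eq {t : ℝ≥0} {l : E} (ht : 0 < t) (h : Tendsto X (𝓝[<] t) (𝓝 l)) :
    leftVal X t = l := by
  have : (𝓝[<] t).NeBot := nhdsLT_neBot_of_exists_lt ⟨0, ht⟩
  exact leftLim_eq_of_tendsto h

theorem leftVal_zero (X : ℝ≥0 → E) : leftVal X 0 = X 0 :=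
  leftLim_eq_of_isBot fun _ => zero_le

variable {F : Type*} [NormedAddCommGroup F] {A : ℝ≥0 → F}

theorem IsCadlag.fst (h : IsCadlag fun t => (A t, X t)) : IsCadlag A :=
  ⟨fun t => (continuous_fst.tendsto _).comp (h.1 t), fun t ht =>
    let ⟨l, hl⟩ := h.2 t ht; ⟨l.1, (continuous_fst.tendsto _).comp hl⟩⟩

theorem IsCadlag.snd (h : IsCadlag fun t => (A t, X t)) : IsCadlag X :=
  ⟨fun t => (continuous_snd.tendsto _).comp (h.1 t), fun t ht =>
    let ⟨l, hl⟩ := h.2 t ht; ⟨l.2, (continuous_snd.tendsto _).comp hl⟩⟩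

theorem leftVal_prodMk (h : IsCadlag fun t => (A t, X t)) (t : ℝ≥0) :
    leftVal (fun t => (A t, X t)) t = (leftVal A t, leftVal X t) := by
  rcases eq_or_lt_of_le (zero_le : 0 ≤ t) with rfl | ht
  · simp only [leftVal_zero]
  · exact leftVal_eq ht ((h.fst.tendsto_leftVal t).prodMk_nhds (h.snd.tendsto_leftVal t))

end Paths

/-! ### Cells on which a càglàd path oscillates little -/

/-- A path with left and right limits that is left continuous splits `(0, T]` into finitely many
cells `(p, p']` of oscillation less than `δ`. Two points `u ≤ v` belong to the same cell of a
finite set `P` if no point of `P` lies in `[u, v)`. -/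
theorem exists_finset_cells {Y : Type*} [PseudoMetricSpace Y] {g : ℝ≥0 → Y}
    (hl : ∀ t, Tendsto g (𝓝[<] t) (𝓝 (g t))) (hr : ∀ t, ∃ y, Tendsto g (𝓝[>] t) (𝓝 y))
    (T : ℝ≥0) {δ : ℝ} (hδ : 0 < δ) :
    ∃ P : Finset ℝ≥0, ∀ u v, 0 < u → u ≤ v → v ≤ T → (∀ p ∈ P, u ≤ p → v ≤ p) →
      dist (g u) (g v) < δ := by
  -- Around each `c` there are an interval `(a, c]` and an interval `(c, b]` of small oscillation.
  -- The point `0` is added for the sake of `c = 0`, whose neighbourhoods in `ℝ≥0` contain it.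
  have key : ∀ c : ℝ≥0, ∃ a b : ℝ≥0, insert 0 (Ioc a b) ∈ 𝓝 c ∧
      (∀ u ∈ Ioc a c, ∀ v ∈ Ioc a c, dist (g u) (g v) < δ) ∧
      (∀ u ∈ Ioc c b, ∀ v ∈ Ioc c b, dist (g u) (g v) < δ) := by
    intro c
    obtain ⟨y, hy⟩ := hr c
    obtain ⟨b, hcb, hb⟩ := (mem_nhdsGT_iff_exists_Ioc_subset).1
      (hy (Metric.ball_mem_nhds y (half_pos hδ)))
    have hb' : ∀ u ∈ Ioc c b, ∀ v ∈ Ioc c b, dist (g u) (g v) < δ := fun u hu v hv => by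
      have h1 := Metric.mem_ball.1 (hb hu)
      have h2 := Metric.mem_ball.1 (hb hv)
      linarith [dist_triangle_right (g u) (g v) y]
    rcases eq_or_lt_of_le (zero_le : 0 ≤ c) with rfl | hc
    · refine ⟨0, b, ?_, fun u hu => absurd hu (by simp), hb'⟩
      filter_upwards [Iio_mem_nhds hcb] with x hx
      rcases eq_or_lt_of_le (zero_le : 0 ≤ x) with rfl | h0
      · exact Or.inl rfl
      · exact Or.inr ⟨h0, le_of_lt hx⟩
    · obtain ⟨a, hac, ha⟩ := (mem_nhdsLT_iff_exists_Ioo_subset' hc).1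
        (hl c (Metric.ball_mem_nhds (g c) (half_pos hδ)))
      have ha' : ∀ u ∈ Ioc a c, dist (g u) (g c) < δ / 2 := fun u hu => by
        rcases eq_or_lt_of_le hu.2 with rfl | h
        · simpa using hδ
        · exact Metric.mem_ball.1 (ha ⟨hu.1, h⟩)
      refine ⟨a, b, ?_, fun u hu v hv => ?_, hb'⟩
      · filter_upwards [Ioo_mem_nhds hac hcb] with x hx
        exact Or.inr ⟨hx.1, hx.2.le⟩
      · linarith [dist_triangle_right (g u) (g v) (g c), ha' u hu, ha' v hv]
  choose a b hab h1 h2 using key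
  obtain ⟨S, -, hS⟩ := (isCompact_Icc (a := (0 : ℝ≥0)) (b := T)).elim_nhds_subcover
    (fun c => insert 0 (Ioc (a c) (b c))) fun c _ => hab c
  refine ⟨S ∪ S.image b, fun u v hu huv hv hP => ?_⟩
  obtain ⟨c, hc, huc⟩ := mem_iUnion₂.1 (hS ⟨hu.le, huv.trans hv⟩)
  have huc' : u ∈ Ioc (a c) (b c) := huc.resolve_left hu.ne'
  have hvb : v ≤ b c :=
    hP _ (Finset.mem_union_right _ (Finset.mem_image_of_mem _ hc)) huc'.2
  rcases le_or_gt u c with h | h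
  · have hvc : v ≤ c := hP c (Finset.mem_union_left _ hc) h
    exact h1 c u ⟨huc'.1, h⟩ v ⟨huc'.1.trans_le huv, hvc⟩
  · exact h2 c u ⟨h, huc'.2⟩ v ⟨h.trans_le huv, hvb⟩

section Cadlag

variable {E : Type*} [NormedAddCommGroup E] {X : ℝ≥0 → E}

theorem IsCadlag.exists_finset_cells_comp (h : IsCadlag X) {Y : Type*} [PseudoMetricSpace Y]
    {H : E → Y} (hH : Continuous H) (T : ℝ≥0) {δ : ℝ} (hδ : 0 < δ) :
    ∃ P : Finset ℝ≥0, ∀ u v, 0 < u → u ≤ v → v ≤ T → (∀ p ∈ P, u ≤ p → v ≤ p) →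
      dist (H (leftVal X u)) (H (leftVal X v)) < δ :=
  exists_finset_cells (g := fun u => H (leftVal X u))
    (fun t => (hH.tendsto _).comp (h.leftVal_tendsto_left t))
    (fun t => ⟨_, (hH.tendsto _).comp (h.leftVal_tendsto_right t)⟩) T hδ

/-- A càdlàg path has finitely many jumps of norm at least `ε` in a bounded interval: they occur at
end points of cells of oscillation less than `ε / 2`. -/
theorem IsCadlag.finite_largeJumpSet (h : IsCadlag X) {ε : ℝ} (hε : 0 < ε) (T : ℝ≥0) :
    (Ioc 0 T ∩ largeJumpSet ε X).Finite := by
  obtain ⟨P, hP⟩ := h.exists_finset_cells_comp continuous_id T (half_pos hε)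
  refine (insert T P).finite_toSet.subset fun u hu => ?_
  by_contra hu'
  simp only [Finset.coe_insert, mem_insert_iff, Finset.mem_coe, not_or] at hu'
  have huT : u < T := lt_of_le_of_ne hu.1.2 hu'.1
  -- the points of the cell of `u` to the right of `u` accumulate at `u`
  have hev : ∀ᶠ v in 𝓝[>] u, ∀ p ∈ P, u ≤ p → v ≤ p := by
    rw [Filter.eventually_all_finset]
    intro p hp
    rcases lt_or_ge p u with h1 | h1
    · exact Eventually.of_forall fun v h2 => absurd h1 (not_lt.2 h2)
    · have : u < p := lt_of_le_of_ne h1 fun h3 => hu'.2 (h3 ▸ hp)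
      filter_upwards [Ioo_mem_nhdsGT this] with v hv _ using hv.2.le
  have hle : dist (leftVal X u) (X u) ≤ ε / 2 := by
    refine le_of_tendsto (tendsto_const_nhds.dist (h.leftVal_tendsto_right u)) ?_
    filter_upwards [hev, Ioo_mem_nhdsGT huT] with v h1 h2
    exact (hP u v hu.1.1 h2.1.le h2.2.le h1).le
  have : ε ≤ ‖jump X u‖ := hu.2
  rw [jump, ← dist_eq_norm, dist_comm] at this
  linarith

/-- A càdlàg path in a Banach space has relatively compact range on bounded intervals. -/
theorem IsCadlag.exists_compact [CompleteSpace E] (h : IsCadlag X) (T : ℝ≥0) :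
    ∃ C : Set E, IsCompact C ∧ (∀ u ≤ T, X u ∈ C) ∧ ∀ u ≤ T, leftVal X u ∈ C := by
  -- the left limits at the right end points of small cells form a finite net
  have htb : TotallyBounded (leftVal X '' Ioc 0 (T + 1)) := by
    rw [Metric.totallyBounded_iff]
    intro ε hε
    obtain ⟨P, hP⟩ := h.exists_finset_cells_comp continuous_id (T + 1) hε
    refine ⟨leftVal X '' ((insert (T + 1) P : Finset ℝ≥0) : Set ℝ≥0),
      (Finset.finite_toSet _).image _, ?_⟩
    rintro _ ⟨u, hu, rfl⟩
    have hne : ((insert (T + 1) P).filter (u ≤ ·)).Nonempty := ⟨T + 1, by simp [hu.2]⟩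
    set p := ((insert (T + 1) P).filter (u ≤ ·)).min' hne with hp
    have hpm := Finset.min'_mem _ hne
    rw [← hp, Finset.mem_filter] at hpm
    have hpT : p ≤ T + 1 := Finset.min'_le _ _ (by simp [hu.2])
    refine mem_iUnion₂.2 ⟨leftVal X p, mem_image_of_mem _ hpm.1, Metric.mem_ball.2 ?_⟩
    refine hP u p hu.1 hpm.2 hpT fun q hq huq => Finset.min'_le _ _ ?_
    simp [hq, huq]
  have hX : ∀ u ≤ T, X u ∈ closure (leftVal X '' Ioc 0 (T + 1)) := fun u hu => by
    refine mem_closure_of_tendsto (h.leftVal_tendsto_right u) ?_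
    have hlt : u < T + 1 := hu.trans_lt (lt_add_one T)
    filter_upwards [Ioo_mem_nhdsGT hlt] with v hv
    exact mem_image_of_mem _ ⟨(zero_le : 0 ≤ u).trans_lt hv.1, hv.2.le⟩
  refine ⟨_, htb.closure.isCompact_of_isClosed isClosed_closure, hX, fun u hu => ?_⟩
  rcases eq_or_lt_of_le (zero_le : 0 ≤ u) with rfl | h0
  · rw [leftVal_zero]; exact hX 0 hu
  · exact subset_closure (mem_image_of_mem _ ⟨h0, hu.trans (le_add_of_nonneg_right zero_le)⟩)

end Cadlag

/-! ### The topology of `L_c` on metric spaces -/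

section Lc

variable {E G : Type*} [NormedAddCommGroup E] [NormedSpace ℝ E]
  [NormedAddCommGroup G] [NormedSpace ℝ G]

theorem rho_le_opNorm (K : Set E) (T : E →L[ℝ] G) : rho K T ≤ ‖T‖ :=
  rho_le (norm_nonneg _) fun x _ => T.le_opNorm x

/-- On a metric space, a map that is continuous into `L_c(E, G)` is continuous in operator norm:
if `‖T_n‖ ≥ ε` then `‖T_n x_n‖ ≥ (ε / 2) ‖x_n‖` for some null sequence `x_n`, which together with
its limit forms a compact set `K`, and so `ρ_K(T_n) ≥ ε / 2`. -/
theorem LcContinuous.continuous {Z : Type*} [PseudoMetricSpace Z] {φ : Z → E →L[ℝ] G}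
    (h : LcContinuous φ) : Continuous φ := by
  rw [lcContinuous_iff] at h
  rw [continuous_iff_seqContinuous]
  intro z z₀ hz
  rw [Metric.tendsto_atTop]
  by_contra hcon
  push Not at hcon
  obtain ⟨ε, hε, hcon⟩ := hcon
  have hx : ∀ n : ℕ, ∃ x : E, ‖x‖ < 1 ∧
      (ε / 2 ≤ ‖φ (z n) - φ z₀‖ → ε / 4 < ‖(φ (z n) - φ z₀) x‖) := fun n => by
    by_cases hn : ε / 2 ≤ ‖φ (z n) - φ z₀‖
    · obtain ⟨x, h1, h2⟩ := (φ (z n) - φ z₀).exists_lt_apply_of_lt_opNorm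
        (show ε / 4 < _ by linarith)
      exact ⟨x, h1, fun _ => h2⟩
    · exact ⟨0, by simp, fun h => absurd h hn⟩
  choose x hx1 hx2 using hx
  -- rescaling `x n` to a null sequence does not affect the ratio of `‖T x‖` to `‖x‖`
  set y : ℕ → E := fun n => ((n : ℝ) + 1)⁻¹ • x n with hy
  have hy0 : Tendsto y atTop (𝓝 0) := by
    refine squeeze_zero_norm (a := fun n : ℕ => ((n : ℝ) + 1)⁻¹) (fun n => ?_) ?_
    · rw [hy, norm_smul, Real.norm_of_nonneg (by positivity)]
      exact mul_le_of_le_one_right (by positivity) (hx1 n).le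
    · simpa [one_div] using tendsto_one_div_add_atTop_nhds_zero_nat (𝕜 := ℝ)
  have hK := hy0.isCompact_insert_range
  obtain ⟨N, hN⟩ := eventually_atTop.1 (hz.eventually (h z₀ _ hK (ε / 4) (by positivity)))
  obtain ⟨n, hn, hd⟩ := hcon N
  rw [dist_eq_norm, Function.comp_apply] at hd
  have h1 := norm_apply_le_rho (φ (z n) - φ z₀) (mem_insert_of_mem 0 (mem_range_self (f := y) n))
  have h2 := hN n hn
  have h3 := hx2 n (by linarith)
  have hc : (0 : ℝ) < ((n : ℝ) + 1)⁻¹ := by positivity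
  simp only [hy, map_smul, norm_smul, Real.norm_of_nonneg hc.le] at h1 h2
  have h4 : ε / 4 * (((n : ℝ) + 1)⁻¹ * ‖x n‖) ≤ ε / 4 * ((n : ℝ) + 1)⁻¹ := by
    gcongr
    exact mul_le_of_le_one_right hc.le (hx1 n).le
  have h5 : ((n : ℝ) + 1)⁻¹ * (ε / 4) < ((n : ℝ) + 1)⁻¹ * ‖(φ (z n) - φ z₀) (x n)‖ := by gcongr
  have h6 := mul_le_mul_of_nonneg_right h2.le (show 0 ≤ ((n : ℝ) + 1)⁻¹ * ‖x n‖ by positivity)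
  linarith

theorem weakTendsto_iff {u : ℕ → G} {z : G} :
    WeakTendsto u z ↔ ∀ φ : G →L[ℝ] ℝ, Tendsto (fun n => φ (u n)) atTop (𝓝 (φ z)) := by
  have hinj : Function.Injective (topDualPairing ℝ G).flip := fun x y hxy => by
    by_contra hne
    obtain ⟨φ, -, hφ⟩ := exists_dual_vector ℝ (x - y) (norm_ne_zero_iff.2 (sub_ne_zero.2 hne))
    have h1 : φ x = φ y := LinearMap.congr_fun hxy φ
    rw [map_sub, h1, sub_self] at hφ
    exact hne (sub_eq_zero.1 (norm_eq_zero.1 (by simpa using hφ.symm)))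
  exact WeakBilin.tendsto_iff_forall_eval_tendsto (topDualPairing ℝ G).flip hinj

end Lc

/-! ### Elements of a partition -/

namespace HalfLinePartition

variable (π : HalfLinePartition)

theorem lower_lt {t : ℝ≥0} (ht : 0 < t) : π.lower t < t := (π.mem_Ioc_lower_upper ht).1

theorem le_upper {t : ℝ≥0} (ht : 0 < t) : t ≤ π.upper t := (π.mem_Ioc_lower_upper ht).2

theorem idx_eq {t : ℝ≥0} {i : ℕ} (h : t ∈ Ioc (π.pt i) (π.pt (i + 1))) : π.idx t = i := by
  have ht : 0 < t := (zero_le : 0 ≤ π.pt i).trans_lt h.1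
  have h' := π.mem_Ioc_lower_upper ht
  have h1 : π.idx t < i + 1 := π.strictMono.lt_iff_lt.1 (h'.1.trans_le h.2)
  have h2 : i < π.idx t + 1 := π.strictMono.lt_iff_lt.1 (h.1.trans_le h'.2)
  omega

theorem pt_lt_iff {t : ℝ≥0} (ht : 0 < t) {i : ℕ} : π.pt i < t ↔ i ≤ π.idx t := by
  refine ⟨fun h => ?_, fun h => (π.strictMono.monotone h).trans_lt (π.lower_lt ht)⟩
  have : i < π.idx t + 1 := π.strictMono.lt_iff_lt.1 (h.trans_le (π.le_upper ht))
  omega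

/-- If `s` lies between `p` and the right end point of the element containing `p`, then it lies in
the same element. -/
theorem idx_eq_of_le {p s : ℝ≥0} (hp : 0 < p) (hps : p ≤ s) (hs : s ≤ π.upper p) :
    π.idx s = π.idx p :=
  π.idx_eq ⟨(π.lower_lt hp).trans_le hps, hs⟩

theorem exists_le_pt (t : ℝ≥0) : ∃ N, t ≤ π.pt N :=
  (π.tendsto_atTop.eventually_ge_atTop t).exists

/-- An index past which the partition points exceed `t`. -/
noncomputable def bound (t : ℝ≥0) : ℕ := (π.exists_le_pt t).choose

theorem le_pt_bound (t : ℝ≥0) : t ≤ π.pt (π.bound t) := (π.exists_le_pt t).choose_spec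

end HalfLinePartition

section Sums

variable {E : Type*} [NormedAddCommGroup E]

theorem finsum_eq_sum_range {G : Type*} [AddCommMonoid G] {F : ℕ → G} {N : ℕ}
    (h : ∀ i, N ≤ i → F i = 0) : ∑ᶠ i, F i = ∑ i ∈ Finset.range N, F i := by
  refine finsum_eq_sum_of_support_subset _ fun i hi => ?_
  simp only [Finset.coe_range, mem_Iio]
  by_contra hlt
  exact hi (h i (not_lt.1 hlt))

theorem incr_eq_zero_of_bound_le (X : ℝ≥0 → E) (π : HalfLinePartition) {t : ℝ≥0} {i : ℕ}
    (hi : π.bound t ≤ i) : incr X π t i = 0 :=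
  incr_eq_zero X π ((π.le_pt_bound t).trans (π.strictMono.monotone hi))

variable [NormedSpace ℝ E] {G : Type*} [NormedAddCommGroup G] [NormedSpace ℝ G]

theorem leftRiemannSum_eq (H : ℝ≥0 → E →L[ℝ] G) (X : ℝ≥0 → E) (π : HalfLinePartition) (t : ℝ≥0) :
    leftRiemannSum H X π t = ∑ i ∈ Finset.range (π.bound t), H (π.pt i) (incr X π t i) :=
  finsum_eq_sum_range fun i hi => by rw [incr_eq_zero_of_bound_le X π hi, map_zero]

end Sums

/-! ### Consequences of Condition (C) -/

section ConditionC

variable {E : Type*} [NormedAddCommGroup E] {Z : ℝ≥0 → E} {π : ℕ → HalfLinePartition}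

/-- `p` is a regular point for the time horizon `t` if the value of the path at the right end
point of the element of the partition that contains `p` tends to its value at `p`. -/
def IsRegularPoint (Z : ℝ≥0 → E) (π : ℕ → HalfLinePartition) (t p : ℝ≥0) : Prop :=
  Tendsto (fun n => Z (min ((π n).upper p) t)) atTop (𝓝 (Z p))

/-- Jump times are regular: both the increments over their elements and the values at the left end
points converge. -/
theorem isRegularPoint_of_jump (hC : ConditionC Z π) (hleft : ApproximatesFromLeft π Z)
    {s t : ℝ≥0} (hs : 0 < s) (hst : s ≤ t) (hj : s ∈ jumpSet Z) : IsRegularPoint Z π t s := by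
  have h := (hC.c2 s hj t hst).add (hleft s hs)
  have e : jump Z s + leftVal Z s = Z s := by simp [jump]
  rw [e] at h
  refine h.congr fun n => ?_
  rw [min_eq_left (((π n).lower_lt hs).le.trans hst), sub_add_cancel]

theorem isRegularPoint_self {t : ℝ≥0} (ht : 0 < t) : IsRegularPoint Z π t t := by
  have : ∀ n, min ((π n).upper t) t = t := fun n => min_eq_right ((π n).le_upper ht)
  simp only [IsRegularPoint, this]
  exact tendsto_const_nhds

theorem largeJumpPart_eq_of_forall {ε : ℝ} {u v : ℝ≥0} (huv : u ≤ v)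
    (h : ∀ s ∈ largeJumpSet ε Z, s ≤ v → s ≤ u) : largeJumpPart ε Z v = largeJumpPart ε Z u := by
  have : Ioc 0 v ∩ largeJumpSet ε Z = Ioc 0 u ∩ largeJumpSet ε Z := by
    ext s
    exact ⟨fun hs => ⟨⟨hs.1.1, h s hs.2 hs.1.2⟩, hs.2⟩,
      fun hs => ⟨⟨hs.1.1, hs.1.2.trans huv⟩, hs.2⟩⟩
  simp only [largeJumpPart, this]

/-- The third part of Condition (C) in the form in which it is used: for some small `ε`, the path
without its jumps of norm at least `ε` eventually oscillates by less than `η`. -/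
theorem ConditionC.exists_osc_lt (hC : ConditionC Z π) (t : ℝ≥0) {η : ℝ} (hη : 0 < η) :
    ∃ ε > 0, ε < η ∧ ∀ᶠ n in atTop,
      oscPlus (fun u => Z u - largeJumpPart ε Z u) (π n) t < ENNReal.ofReal η := by
  have h := hC.c3 t
  have h1 := eventually_lt_of_limsup_lt (h.trans_lt (ENNReal.ofReal_pos.2 hη))
  obtain ⟨ε, hε, h2⟩ := (h1.and (Ioo_mem_nhdsGT hη)).exists
  exact ⟨ε, h2.1, h2.2, eventually_lt_of_limsup_lt hε⟩

/-- Two points of the same element of the partition without large jumps between them are close. -/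
theorem dist_lt_of_osc {ε η : ℝ} {P : HalfLinePartition} {t : ℝ≥0}
    (h : oscPlus (fun u => Z u - largeJumpPart ε Z u) P t < ENNReal.ofReal η) {i : ℕ} {u v : ℝ≥0}
    (hu : P.pt i < u) (huv : u ≤ v) (hv : v ≤ P.pt (i + 1)) (hvt : v ≤ t)
    (hJ : ∀ s ∈ largeJumpSet ε Z, s ≤ v → s ≤ u) : dist (Z u) (Z v) < η := by
  have h1 : edist (Z u - largeJumpPart ε Z u) (Z v - largeJumpPart ε Z v) < ENNReal.ofReal η := by
    refine lt_of_le_of_lt ?_ h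
    refine le_trans ?_ (le_iSup _ i)
    exact Metric.edist_le_ediam_of_mem (mem_image_of_mem (fun u => Z u - largeJumpPart ε Z u)
      ⟨⟨hu, huv.trans hv⟩, huv.trans hvt⟩)
      (mem_image_of_mem (fun u => Z u - largeJumpPart ε Z u) ⟨⟨hu.trans_le huv, hv⟩, hvt⟩)
  rw [largeJumpPart_eq_of_forall huv hJ, edist_dist, dist_sub_right] at h1
  exact (ENNReal.ofReal_lt_ofReal_iff_of_nonneg dist_nonneg).1 h1

/-- The increment of the path over an element of the partition without large jumps is small; right
continuity of the path takes care of the left end point. -/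
theorem norm_sub_le_of_osc (hZ : IsCadlag Z) {ε η : ℝ} {P : HalfLinePartition} {t : ℝ≥0}
    (h : oscPlus (fun u => Z u - largeJumpPart ε Z u) P t < ENNReal.ofReal η) (hη : 0 < η) {i : ℕ}
    (hJ : ∀ s ∈ largeJumpSet ε Z, s ≤ t → s ∉ Ioc (P.pt i) (P.pt (i + 1))) :
    ‖Z (min (P.pt (i + 1)) t) - Z (min (P.pt i) t)‖ ≤ η := by
  rcases le_or_gt t (P.pt i) with ht | ht
  · rw [min_eq_right ht, min_eq_right (ht.trans (P.strictMono (Nat.lt_succ_self i)).le)]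
    simpa using hη.le
  rw [min_eq_left ht.le]
  set v := min (P.pt (i + 1)) t with hv
  have hlt : P.pt i < v := lt_min (P.strictMono (Nat.lt_succ_self i)) ht
  rw [← dist_eq_norm, dist_comm]
  refine le_of_tendsto ((hZ.1 (P.pt i)).dist tendsto_const_nhds) ?_
  filter_upwards [Ioo_mem_nhdsGT hlt] with u hu
  refine (dist_lt_of_osc h hu.1 hu.2.le (min_le_left _ _) (min_le_right _ _) fun s hs hsv => ?_).le
  by_contra hcon
  exact hJ s hs (hsv.trans (min_le_right _ _))
    ⟨hu.1.trans (not_le.1 hcon), hsv.trans (min_le_left _ _)⟩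

/-- If `p` is not regular then infinitely many elements of the partitions contain `p` and a common
later jump time `s`. The left end points being common, the path of left limits is constant on
`[p, s]`. -/
theorem exists_const_of_not_isRegularPoint (hZ : IsCadlag Z) (hC : ConditionC Z π)
    (hleft : ApproximatesFromLeft π Z) {t p : ℝ≥0} (hp : 0 < p) (hpt : p ≤ t)
    (h : ¬ IsRegularPoint Z π t p) :
    ∃ s, p < s ∧ s ≤ t ∧ IsRegularPoint Z π t s ∧
      ∀ u, p ≤ u → u ≤ s → leftVal Z u = leftVal Z s := by
  rw [IsRegularPoint, Metric.tendsto_nhds] at h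
  push Not at h
  obtain ⟨c, hc, hfr⟩ := h
  obtain ⟨ε, hε, -, hosc⟩ := hC.exists_osc_lt t hc
  -- where `Z` moves by at least `c` between `p` and the right end point, a large jump intervenes
  have hfr2 : ∃ᶠ n in atTop, ∃ s ∈ Ioc 0 t ∩ largeJumpSet ε Z, p < s ∧ s ≤ (π n).upper p := by
    refine (hfr.and_eventually hosc).mono fun n ⟨h1, h2⟩ => ?_
    by_contra hcon
    push Not at hcon
    refine absurd (dist_lt_of_osc h2 ((π n).lower_lt hp) (le_min ((π n).le_upper hp) hpt)
      (min_le_left _ _) (min_le_right _ _) fun s hs hsv => ?_) (not_lt.2 (by rwa [dist_comm]))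
    by_contra hps
    have hps' := not_le.1 hps
    exact absurd (hsv.trans (min_le_left _ _))
      (not_le.2 (hcon s ⟨⟨hp.trans hps', hsv.trans (min_le_right _ _)⟩, hs⟩ hps'))
  -- as there are finitely many large jumps, one of them does so infinitely often
  have hfin := hZ.finite_largeJumpSet hε t
  obtain ⟨s, hs, hfr3⟩ : ∃ s ∈ Ioc 0 t ∩ largeJumpSet ε Z,
      ∃ᶠ n in atTop, p < s ∧ s ≤ (π n).upper p := by
    by_contra hcon
    push Not at hcon
    refine hfr2 ?_
    filter_upwards [(Filter.eventually_all_finite hfin).2 fun s hs => hcon s hs] with n hn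
    rintro ⟨s, hs, h1⟩
    exact absurd h1.2 (not_le.2 (hn s hs h1.1))
  obtain ⟨hps, -⟩ := hfr3.exists.choose_spec
  refine ⟨s, hps, hs.1.2, isRegularPoint_of_jump hC hleft hs.1.1 hs.1.2
    (hε.trans_le hs.2).ne', fun u hpu hus => ?_⟩
  refine tendsto_nhds_unique_of_frequently_eq (hleft u (hp.trans_le hpu)) (hleft s hs.1.1) ?_
  refine hfr3.mono fun n hn => ?_
  rw [HalfLinePartition.lower, HalfLinePartition.lower, (π n).idx_eq_of_le hp hps.le hn.2,
    (π n).idx_eq_of_le hp hpu (hus.trans hn.2)]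

/-- The cells on which a continuous function of the left limits oscillates little can be chosen
with regular end points: a point that is not regular is moved to the right end of the interval of
constancy that starts there. -/
theorem exists_regular_cells (hZ : IsCadlag Z) (hC : ConditionC Z π)
    (hleft : ApproximatesFromLeft π Z) {Y : Type*} [PseudoMetricSpace Y] {H : E → Y}
    (hH : Continuous H) {t : ℝ≥0} (ht : 0 < t) {δ : ℝ} (hδ : 0 < δ) :
    ∃ P : Finset ℝ≥0, t ∈ P ∧ (∀ p ∈ P, 0 < p ∧ p ≤ t ∧ IsRegularPoint Z π t p) ∧
      ∀ u v, 0 < u → u ≤ v → v ≤ t → (∀ p ∈ P, u ≤ p → v ≤ p) →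
        dist (H (leftVal Z u)) (H (leftVal Z v)) < δ := by
  obtain ⟨P, hP⟩ := hZ.exists_finset_cells_comp hH t hδ
  have key : ∀ p : ℝ≥0, ∃ s : ℝ≥0, 0 < p → p ≤ t → p ≤ s ∧ s ≤ t ∧ IsRegularPoint Z π t s ∧
      ∀ u, p ≤ u → u ≤ s → leftVal Z u = leftVal Z p := by
    intro p
    by_cases hp : 0 < p ∧ p ≤ t
    · by_cases hr : IsRegularPoint Z π t p
      · exact ⟨p, fun _ _ => ⟨le_rfl, hp.2, hr, fun u h1 h2 => by rw [le_antisymm h2 h1]⟩⟩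
      · obtain ⟨s, h1, h2, h3, h4⟩ :=
          exists_const_of_not_isRegularPoint hZ hC hleft hp.1 hp.2 hr
        exact ⟨s, fun _ _ => ⟨h1.le, h2, h3, fun u h5 h6 => by rw [h4 u h5 h6, h4 p le_rfl h1.le]⟩⟩
    · exact ⟨p, fun h1 h2 => absurd ⟨h1, h2⟩ hp⟩
  choose s hs using key
  refine ⟨insert t ((P.filter fun p => 0 < p ∧ p ≤ t).image s), Finset.mem_insert_self _ _,
    fun q hq => ?_, fun u v hu huv hv hcell => ?_⟩
  · rcases Finset.mem_insert.1 hq with rfl | hq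
    · exact ⟨ht, le_rfl, isRegularPoint_self ht⟩
    · obtain ⟨p, hp, rfl⟩ := Finset.mem_image.1 hq
      obtain ⟨-, h0, h1⟩ := Finset.mem_filter.1 hp
      obtain ⟨h2, h3, h4, -⟩ := hs p h0 h1
      exact ⟨h0.trans_le h2, h3, h4⟩
  · -- The first point `p` of `P` in `[u, v)`, if any, has been moved to `s p ≥ v`, so that the left
    -- limits are constant on `[p, v]`, while `u` and `p` belong to the same cell of `P`.
    by_cases hne : (P.filter fun p => u ≤ p ∧ p < v).Nonempty
    · set p := (P.filter fun p => u ≤ p ∧ p < v).min' hne with hpdef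
      have hpm := Finset.min'_mem _ hne
      rw [← hpdef, Finset.mem_filter] at hpm
      obtain ⟨hpP, hup, hpv⟩ := hpm
      obtain ⟨h1, -, -, h4⟩ := hs p (hu.trans_le hup) (hpv.le.trans hv)
      have hvs : v ≤ s p := hcell _ (Finset.mem_insert_of_mem (Finset.mem_image_of_mem _
        (Finset.mem_filter.2 ⟨hpP, hu.trans_le hup, hpv.le.trans hv⟩))) (hup.trans h1)
      rw [h4 v hpv.le hvs]
      refine hP u p hu hup (hpv.le.trans hv) fun q hq huq => ?_
      rcases lt_or_ge q v with h | h
      · exact Finset.min'_le _ _ (Finset.mem_filter.2 ⟨hq, huq, h⟩)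
      · exact hpv.le.trans h
    · refine hP u v hu huv hv fun q hq huq => ?_
      by_contra hcon
      exact hne ⟨q, Finset.mem_filter.2 ⟨hq, huq, not_le.1 hcon⟩⟩

end ConditionC

/-! ### Simple functions and Stieltjes integrals -/

/-- A finite set of points and the end points of `[0, t]` can be listed in increasing order. -/
theorem exists_refinement (P : Finset ℝ≥0) (t : ℝ≥0) :
    ∃ (u : ℕ → ℝ≥0) (N : ℕ), Monotone u ∧ u 0 = 0 ∧ u N = t ∧ (∀ k, u k ≤ t) ∧
      ∀ k, ∀ p ∈ P, p ≤ u k ∨ u (k + 1) ≤ p := by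
  classical
  set S : Finset ℝ≥0 := insert 0 (insert t (P.filter (· ≤ t))) with hS
  have h0 : (0 : ℝ≥0) ∈ S := by simp [hS]
  have htS : t ∈ S := by simp [hS]
  have hSt : ∀ p ∈ S, p ≤ t := by
    intro p hp
    simp only [hS, Finset.mem_insert, Finset.mem_filter] at hp
    rcases hp with rfl | rfl | hp
    · exact zero_le
    · exact le_rfl
    · exact hp.2
  obtain ⟨N, hN⟩ : ∃ N, S.card = N + 1 :=
    ⟨S.card - 1, by have := Finset.card_pos.2 ⟨_, h0⟩; omega⟩
  let e := S.orderIsoOfFin hN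
  let f : ℕ → Fin (N + 1) := fun k => ⟨min k N, by omega⟩
  have hf : Monotone f := fun a b hab => Fin.mk_le_mk.2 (min_le_min_right N hab)
  have hsurj : ∀ p ∈ S, ∃ j : Fin (N + 1), (e j : ℝ≥0) = p := fun p hp =>
    ⟨e.symm ⟨p, hp⟩, by simp⟩
  refine ⟨fun k => e (f k), N, fun a b hab => e.monotone (hf hab), ?_, ?_,
    fun k => hSt _ (e (f k)).2, fun k p hp => ?_⟩
  · obtain ⟨j, hj⟩ := hsurj 0 h0
    refine le_antisymm ?_ zero_le
    rw [← hj]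
    exact e.monotone (by simp [f])
  · obtain ⟨j, hj⟩ := hsurj t htS
    refine le_antisymm (hSt _ (e (f N)).2) ?_
    refine hj.symm.le.trans (e.monotone ?_)
    simp only [f, min_self, Fin.le_def]; omega
  · rcases le_or_gt p t with hpt | hpt
    · obtain ⟨j, hj⟩ := hsurj p (by simp [hS, hp, hpt])
      rw [← hj]
      rcases le_or_gt (j : ℕ) k with h | h
      · left
        refine e.monotone ?_
        simp only [f, Fin.le_def]; omega
      · right
        refine e.monotone ?_
        simp only [f, Fin.le_def]; omega
    · exact Or.inr ((hSt _ (e (f (k + 1))).2).trans hpt.le)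

section Aux

variable {E : Type*} [NormedAddCommGroup E] {A : ℝ≥0 → E} {t : ℝ≥0}

open scoped Pointwise in
theorem isCompact_sub {C : Set E} (hC : IsCompact C) : IsCompact (C - C) := by
  rw [sub_eq_add_neg]
  exact hC.add hC.neg

/-- Telescoping up to `p ∧ t` along a list of points which passes through `p`. -/
theorem sum_ite_refinement {u : ℕ → ℝ≥0} {N : ℕ} (hu : Monotone u) (h0 : u 0 = 0) (hN : u N = t)
    {p : ℝ≥0} (hp : ∀ k, p ≤ u k ∨ u (k + 1) ≤ p) :
    ∑ k ∈ Finset.range N, (if u (k + 1) ≤ p then A (u (k + 1)) - A (u k) else 0) =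
      A (min p t) - A 0 := by
  have h1 : ∀ k, (if u (k + 1) ≤ p then A (u (k + 1)) - A (u k) else 0) =
      A (min p (u (k + 1))) - A (min p (u k)) := by
    intro k
    split_ifs with h
    · rw [min_eq_right h, min_eq_right ((hu (Nat.le_succ k)).trans h)]
    · rw [min_eq_left (not_le.1 h).le, min_eq_left ((hp k).resolve_right h), sub_self]
  simp only [h1]
  rw [Finset.sum_range_sub (fun k => A (min p (u k))), h0, hN, min_eq_right (zero_le : 0 ≤ p)]

theorem exists_variation_bound (hA : LocallyBoundedVariationOn A univ) (t : ℝ≥0) :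
    ∃ V : ℝ, 0 ≤ V ∧ ∀ u : ℕ → ℝ≥0, Monotone u → (∀ k, u k ≤ t) → ∀ N,
      ∑ k ∈ Finset.range N, ‖A (u (k + 1)) - A (u k)‖ ≤ V := by
  refine ⟨(eVariationOn A (univ ∩ Icc 0 t)).toReal, ENNReal.toReal_nonneg, fun u hu hut N => ?_⟩
  have hfin := hA 0 t (mem_univ _) (mem_univ _)
  have h1 := eVariationOn.sum_le (f := A) (s := univ ∩ Icc 0 t) (n := N) hu
    fun i => ⟨mem_univ _, zero_le, hut i⟩
  have h2 := ENNReal.toReal_mono hfin h1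
  rwa [ENNReal.toReal_sum fun _ _ => edist_ne_top _ _,
    Finset.sum_congr rfl fun k _ => by rw [← dist_edist, dist_eq_norm]] at h2

/-- The jumps up to time `p ∧ t` as a sum over the fixed index set `(0, t]`. -/
theorem hasSum_jump_le [CompleteSpace E] (hs : Summable fun s : Ioc 0 t => jump A s) (p : ℝ≥0) :
    HasSum (fun s : Ioc 0 t => if (s : ℝ≥0) ≤ p then jump A s else 0)
      (A (min p t) - contPart A (min p t)) := by
  rw [contPart, sub_sub_cancel, tsum_subtype (Ioc 0 (min p t)) (jump A)]
  have e : (fun s : Ioc 0 t => if (s : ℝ≥0) ≤ p then jump A s else 0) =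
      (Ioc 0 (min p t)).indicator (jump A) ∘ ((↑) : Ioc 0 t → ℝ≥0) := by
    ext s
    simp only [Function.comp_apply, indicator, mem_Ioc, le_min_iff, s.2.1, s.2.2, and_true,
      true_and]
  have hsum : Summable fun s : Ioc 0 t => if (s : ℝ≥0) ≤ p then jump A s else 0 :=
    hs.indicator {s | (s : ℝ≥0) ≤ p}
  have hsupp : Function.support ((Ioc 0 (min p t)).indicator (jump A)) ⊆ Ioc 0 t :=
    support_indicator_subset.trans (Ioc_subset_Ioc_right (min_le_right _ _))
  rw [e] at hsum ⊢
  rw [hasSum_subtype_iff_of_support_subset hsupp]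
  exact ((hasSum_subtype_iff_of_support_subset hsupp).1 hsum.hasSum).summable.hasSum

end Aux

section Stieltjes

open scoped Pointwise

variable {E G : Type*} [NormedAddCommGroup E] [NormedSpace ℝ E]
  [NormedAddCommGroup G] [NormedSpace ℝ G]

/-- A finite set of cells carries the simple function whose value on a cell is the value of `g` at
the right end point of the cell. -/
theorem exists_stepFun {P : Finset ℝ≥0} {t : ℝ≥0} (ht : t ∈ P) (g : ℝ≥0 → E →L[ℝ] G) :
    ∃ h : StepFun E G, (∀ j, h.right j ∈ P ∧ (h.left j = 0 ∨ h.left j ∈ P)) ∧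
      ∀ u ∈ Ioc 0 t, ∃ p ∈ P, u ≤ p ∧ (∀ q ∈ P, u ≤ q → p ≤ q) ∧ h.eval u = g p := by
  -- the predecessor of `p` in `P`, or `0` for the first point, as `sup ∅ = 0` in `ℝ≥0`
  set l : ℝ≥0 → ℝ≥0 := fun p => (P.filter (· < p)).sup id with hl
  have hlp : ∀ p, l p ≤ p := fun p => Finset.sup_le fun q hq => (Finset.mem_filter.1 hq).2.le
  have hlt : ∀ u p, 0 < u → (l p < u ↔ ∀ q ∈ P, q < p → q < u) := fun u p hu => by
    rw [hl, Finset.sup_lt_iff (by simpa using hu)]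
    simp
  have hlmem : ∀ p, l p = 0 ∨ l p ∈ P := fun p => by
    by_cases hne : (P.filter (· < p)).Nonempty
    · obtain ⟨q, hq, he⟩ := Finset.exists_mem_eq_sup _ hne id
      exact Or.inr (by rw [hl]; simp only [he]; exact (Finset.mem_filter.1 hq).1)
    · left
      rw [Finset.not_nonempty_iff_eq_empty] at hne
      simp [hl, hne]
  have hdisj : ∀ p ∈ P, ∀ p' ∈ P, p < p' → Disjoint (Ioc (l p) p) (Ioc (l p') p') := by
    intro p hp p' hp' hlt'
    rw [Set.disjoint_left]
    intro u hu hu'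
    exact absurd ((hlt u p' (zero_le.trans_lt hu.1)).1 hu'.1 p hp hlt') (not_lt.2 hu.2)
  let e := P.equivFin.symm
  refine ⟨⟨P.card, fun j => l (e j), fun j => e j, fun j => hlp _, fun j k hjk => ?_,
    fun j => g (e j)⟩, fun j => ⟨(e j).2, hlmem _⟩, fun u hu => ?_⟩
  · have hne : (e j : ℝ≥0) ≠ e k := fun h => hjk (e.injective (Subtype.ext h))
    rcases lt_or_gt_of_ne hne with h | h
    · exact hdisj _ (e j).2 _ (e k).2 h
    · exact (hdisj _ (e k).2 _ (e j).2 h).symm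
  · have hne : (P.filter (u ≤ ·)).Nonempty := ⟨t, Finset.mem_filter.2 ⟨ht, hu.2⟩⟩
    set p := (P.filter (u ≤ ·)).min' hne with hpdef
    have hpm := Finset.min'_mem _ hne
    rw [← hpdef, Finset.mem_filter] at hpm
    have hmin : ∀ q ∈ P, u ≤ q → p ≤ q := fun q hq huq =>
      Finset.min'_le _ _ (Finset.mem_filter.2 ⟨hq, huq⟩)
    have hup : u ∈ Ioc (l p) p := ⟨(hlt u p hu.1).2 fun q hq hqp => by
      by_contra hcon
      exact absurd (hmin q hq (not_lt.1 hcon)) (not_le.2 hqp), hpm.2⟩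
    refine ⟨p, hpm.1, hpm.2, hmin, ?_⟩
    have hj : (e (P.equivFin ⟨p, hpm.1⟩) : ℝ≥0) = p := by simp [e]
    unfold StepFun.eval
    rw [Finset.sum_eq_single (P.equivFin ⟨p, hpm.1⟩)]
    · simp only [hj]
      rw [indicator_of_mem hup]
    · intro k _ hk
      refine indicator_of_notMem (fun hmem => ?_) _
      have hne' : (e k : ℝ≥0) ≠ p := fun h => hk (by
        apply e.injective; apply Subtype.ext; rw [hj]; exact h)
      rcases lt_or_gt_of_ne hne' with h | h
      · exact Set.disjoint_left.1 (hdisj _ (e k).2 _ hpm.1 h) hmem hup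
      · exact Set.disjoint_left.1 (hdisj _ hpm.1 _ (e k).2 h) hup hmem
    · simp

variable {A : ℝ≥0 → E} {t : ℝ≥0}

/-- The integral of a simple function as a Riemann sum over a list of points that refines its
intervals; the function is evaluated at right end points since its intervals contain theirs. -/
theorem StepFun.integral_eq_sum (h : StepFun E G) {u : ℕ → ℝ≥0} {N : ℕ} (hu : Monotone u)
    (h0 : u 0 = 0) (hN : u N = t) (hl : ∀ k j, h.left j ≤ u k ∨ u (k + 1) ≤ h.left j)
    (hr : ∀ k j, h.right j ≤ u k ∨ u (k + 1) ≤ h.right j) :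
    h.integral A t = ∑ k ∈ Finset.range N, h.eval (u (k + 1)) (A (u (k + 1)) - A (u k)) := by
  simp only [StepFun.integral, StepFun.eval, sum_apply]
  rw [Finset.sum_comm]
  refine Finset.sum_congr rfl fun j _ => ?_
  rw [← sub_sub_sub_cancel_right _ _ (A 0), ← sum_ite_refinement hu h0 hN fun k => hl k j,
    ← sum_ite_refinement hu h0 hN fun k => hr k j, ← Finset.sum_sub_distrib, map_sum]
  refine Finset.sum_congr rfl fun k _ => ?_
  have hlr := h.left_le_right j
  by_cases h1 : u (k + 1) ≤ h.left j
  · rw [indicator_of_notMem (fun hm => absurd hm.1 (not_lt.2 h1)), if_pos h1,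
      if_pos (h1.trans hlr)]
    simp
  · by_cases h2 : u (k + 1) ≤ h.right j
    · rw [indicator_of_mem (mem_Ioc.2 ⟨not_le.1 h1, h2⟩), if_neg h1, if_pos h2, sub_zero]
    · rw [indicator_of_notMem (fun hm => h2 hm.2), if_neg h1, if_neg h2]
      simp

/-- Simple functions that are uniformly close in the seminorm `ρ_K`, where `K` contains all the
increments of `A`, have close integrals. -/
theorem StepFun.norm_integral_sub_le (h h' : StepFun E G) {K : Set E}
    (hK : ∀ u v, u ≤ t → v ≤ t → A u - A v ∈ K) {V : ℝ}
    (hV : ∀ u : ℕ → ℝ≥0, Monotone u → (∀ k, u k ≤ t) → ∀ N,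
      ∑ k ∈ Finset.range N, ‖A (u (k + 1)) - A (u k)‖ ≤ V) {c : ℝ} (hc : 0 ≤ c)
    (hle : ∀ s ∈ Ioc 0 t, rho K (h.eval s - h'.eval s) ≤ c) :
    ‖h.integral A t - h'.integral A t‖ ≤ c * V := by
  classical
  obtain ⟨u, N, hu, h0, hN, hut, hP⟩ := exists_refinement
    (((Finset.univ.image h.left ∪ Finset.univ.image h.right) ∪ Finset.univ.image h'.left) ∪
      Finset.univ.image h'.right) t
  rw [h.integral_eq_sum hu h0 hN (fun k j => hP k _ (by simp)) (fun k j => hP k _ (by simp)),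
    h'.integral_eq_sum hu h0 hN (fun k j => hP k _ (by simp)) (fun k j => hP k _ (by simp)),
    ← Finset.sum_sub_distrib]
  refine (norm_sum_le _ _).trans (le_trans ?_ (mul_le_mul_of_nonneg_left (hV u hu hut N) hc))
  rw [Finset.mul_sum]
  refine Finset.sum_le_sum fun k _ => ?_
  rcases eq_or_lt_of_le (zero_le : 0 ≤ u (k + 1)) with hz | hz
  · have : u k = u (k + 1) := le_antisymm (hu (Nat.le_succ k)) (hz ▸ zero_le)
    simp [this]
  · rw [← sub_apply]
    exact (norm_apply_le_rho _ (hK _ _ (hut _) (hut _))).trans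
      (mul_le_mul_of_nonneg_right (hle _ ⟨hz, hut _⟩) (norm_nonneg _))

/-- The Stieltjes integral of a uniform limit of simple functions exists. The compact set that
controls the integrals is `C - C`, where `C` is a compact set containing the range of `A`. -/
theorem exists_hasStieltjesIntegral [CompleteSpace E] [CompleteSpace G] (hcA : IsCadlag A)
    (hA : LocallyBoundedVariationOn A univ) {g : ℝ≥0 → E →L[ℝ] G}
    (hg : ∀ δ > 0, ∃ h : StepFun E G, ∀ s ∈ Ioc 0 t, ‖h.eval s - g s‖ < δ) :
    ∃ z, HasStieltjesIntegral g A t z := by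
  obtain ⟨C, hC, hCA, -⟩ := hcA.exists_compact t
  obtain ⟨V, hV0, hV⟩ := exists_variation_bound hA t
  have hKmem : ∀ u v, u ≤ t → v ≤ t → A u - A v ∈ C - C := fun u v hu hv =>
    Set.sub_mem_sub (hCA u hu) (hCA v hv)
  choose h hh using fun m : ℕ => hg (1 / ((m : ℝ) + 1)) (by positivity)
  have hlim := tendsto_one_div_add_atTop_nhds_zero_nat (𝕜 := ℝ)
  have hcomp : ∀ (f : StepFun E G) (c : ℝ) (m : ℕ), 0 ≤ c →
      (∀ s ∈ Ioc 0 t, rho (C - C) (f.eval s - g s) ≤ c) →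
      ‖f.integral A t - (h m).integral A t‖ ≤ (c + 1 / ((m : ℝ) + 1)) * V := by
    intro f c m hc hf
    refine f.norm_integral_sub_le (h m) hKmem hV (by positivity) fun s hs => ?_
    have e : f.eval s - (h m).eval s = (f.eval s - g s) - ((h m).eval s - g s) := by abel
    rw [e]
    refine (map_sub_le_add (rhoSeminorm G (C - C)) _ _).trans (add_le_add (hf s hs) ?_)
    exact (rho_le_opNorm _ _).trans (hh m s hs).le
  have hcau : CauchySeq fun m => (h m).integral A t := by
    refine cauchySeq_of_le_tendsto_0 (fun N : ℕ => (1 / ((N : ℝ) + 1) + 1 / ((N : ℝ) + 1)) * V)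
      (fun n m N hn hm => ?_) ?_
    · rw [dist_eq_norm]
      refine (hcomp (h n) (1 / ((n : ℝ) + 1)) m (by positivity) fun s hs =>
        (rho_le_opNorm _ _).trans (hh n s hs).le).trans ?_
      gcongr
    · simpa using (hlim.add hlim).mul_const V
  obtain ⟨z, hz⟩ := cauchySeq_tendsto_of_complete hcau
  refine ⟨z, fun K hK δ hδ => ?_, fun ε hε => ⟨C - C, isCompact_sub hC, ε / (V + 1), by positivity,
    fun f hf => ?_⟩⟩
  · obtain ⟨f, hf⟩ := hg δ hδ
    exact ⟨f, fun s hs => (rho_le_opNorm _ _).trans_lt (hf s hs)⟩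
  · have h1 : ‖f.integral A t - z‖ ≤ (ε / (V + 1) + 0) * V := by
      refine le_of_tendsto_of_tendsto (tendsto_const_nhds.sub hz).norm
        ((tendsto_const_nhds.add hlim).mul_const V) (Eventually.of_forall fun m => ?_)
      exact hcomp f _ m (by positivity) fun s hs => (hf s hs).le
    refine h1.trans_lt ?_
    rw [add_zero, div_mul_eq_mul_div, div_lt_iff₀ (by positivity)]
    nlinarith

/-- The Stieltjes integral with respect to the continuous part of a path is the integral with
respect to the path less the sum of the jumps weighted by the integrand. -/
theorem HasStieltjesIntegral.contPart [CompleteSpace E] (hcA : IsCadlag A)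
    (hs : Summable fun s : Ioc 0 t => ‖jump A s‖) {g : ℝ≥0 → E →L[ℝ] G} {z y : G}
    (hz : HasStieltjesIntegral g A t z) (hy : HasSum (fun s : Ioc 0 t => g s (jump A s)) y) :
    HasStieltjesIntegral g (ItoFollmer.contPart A) t (z - y) := by
  obtain ⟨C, hC, hCA, hCA'⟩ := hcA.exists_compact t
  have hint : ∀ h : StepFun E G, HasSum (fun s : Ioc 0 t => h.eval s (jump A s))
      (h.integral A t - h.integral (ItoFollmer.contPart A) t) := by
    intro h
    have e : h.integral A t - h.integral (ItoFollmer.contPart A) t =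
        ∑ j, h.val j ((A (min (h.right j) t) - ItoFollmer.contPart A (min (h.right j) t)) -
          (A (min (h.left j) t) - ItoFollmer.contPart A (min (h.left j) t))) := by
      rw [StepFun.integral, StepFun.integral, ← Finset.sum_sub_distrib]
      refine Finset.sum_congr rfl fun j _ => ?_
      rw [← map_sub]; congr 1; abel
    rw [e]
    have h1 := hasSum_sum (s := Finset.univ) fun j (_ : j ∈ Finset.univ) =>
      (h.val j).hasSum ((hasSum_jump_le hs.of_norm (h.right j)).sub
        (hasSum_jump_le hs.of_norm (h.left j)))
    refine h1.congr_fun fun s => ?_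
    simp only [StepFun.eval, sum_apply]
    refine Finset.sum_congr rfl fun j _ => ?_
    have hlr := h.left_le_right j
    by_cases hl : (s : ℝ≥0) ≤ h.left j
    · rw [indicator_of_notMem (fun hm => absurd hm.1 (not_lt.2 hl)), if_pos hl,
        if_pos (hl.trans hlr)]
      simp
    · by_cases hr : (s : ℝ≥0) ≤ h.right j
      · rw [indicator_of_mem (mem_Ioc.2 ⟨not_le.1 hl, hr⟩), if_neg hl, if_pos hr, sub_zero]
      · rw [indicator_of_notMem (fun hm => hr hm.2), if_neg hl, if_neg hr]
        simp
  refine ⟨hz.approx, fun ε hε => ?_⟩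
  obtain ⟨K, hK, δ, hδ, h1⟩ := hz.tendsto (ε / 2) (half_pos hε)
  set W := ∑' s : Ioc 0 t, ‖jump A s‖ with hW
  have hW0 : 0 ≤ W := tsum_nonneg fun _ => norm_nonneg _
  refine ⟨K ∪ (C - C), hK.union (isCompact_sub hC), min δ (ε / (2 * (W + 1))),
    lt_min hδ (by positivity), fun h hh => ?_⟩
  have h2 := h1 h fun s hs => (rho_mono subset_union_left _).trans_lt
    ((hh s hs).trans_le (min_le_left _ _))
  have h3 : ‖(h.integral A t - h.integral (ItoFollmer.contPart A) t) - y‖ ≤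
      ε / (2 * (W + 1)) * W := by
    have hd := (hint h).sub hy
    refine hd.norm_le_of_bounded (hs.hasSum.mul_left (ε / (2 * (W + 1)))) fun s => ?_
    rw [← sub_apply]
    have hm : jump A s ∈ K ∪ (C - C) :=
      Or.inr (Set.sub_mem_sub (hCA _ s.2.2) (hCA' _ s.2.2))
    exact (norm_apply_le_rho _ hm).trans (mul_le_mul_of_nonneg_right
      ((hh s s.2).le.trans (min_le_right _ _)) (norm_nonneg _))
  have h4 : ε / (2 * (W + 1)) * W ≤ ε / 2 := by
    rw [div_mul_eq_mul_div, div_le_div_iff₀ (by positivity) (by positivity)]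
    nlinarith
  have e : h.integral (ItoFollmer.contPart A) t - (z - y) = (h.integral A t - z) -
      ((h.integral A t - h.integral (ItoFollmer.contPart A) t) - y) := by abel
  rw [e]
  linarith [norm_sub_le (h.integral A t - z)
    ((h.integral A t - h.integral (ItoFollmer.contPart A) t) - y)]

end Stieltjes

/-! ### Convergence of weighted sums along the partitions -/

section Riemann

variable {E V G G' : Type*} [NormedAddCommGroup E] [NormedAddCommGroup V] [NormedSpace ℝ V]
  [NormedAddCommGroup G] [NormedSpace ℝ G] [NormedAddCommGroup G'] [NormedSpace ℝ G']

/-- The right limits of a simple function: the intervals `(l, r]` are replaced by `[l, r)`. -/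
noncomputable def StepFun.rightEval (h : StepFun V G) (s : ℝ≥0) : V →L[ℝ] G :=
  ∑ j, (Ico (h.left j) (h.right j)).indicator (fun _ => h.val j) s

theorem StepFun.eventually_eval_eq (h : StepFun V G) (r : ℝ≥0) :
    ∀ᶠ s in 𝓝[>] r, h.eval s = h.rightEval r := by
  have key : ∀ j, ∀ᶠ s in 𝓝[>] r, (Ioc (h.left j) (h.right j)).indicator (fun _ => h.val j) s =
      (Ico (h.left j) (h.right j)).indicator (fun _ => h.val j) r := by
    intro j
    rcases lt_or_ge r (h.left j) with h1 | h1
    · filter_upwards [Ioo_mem_nhdsGT h1] with s hs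
      rw [indicator_of_notMem fun hm => lt_asymm hm.1 hs.2,
        indicator_of_notMem fun hm => absurd hm.1 (not_le.2 h1)]
    · rcases lt_or_ge r (h.right j) with h2 | h2
      · filter_upwards [Ioo_mem_nhdsGT h2] with s hs
        rw [indicator_of_mem (mem_Ioc.2 ⟨h1.trans_lt hs.1, hs.2.le⟩),
          indicator_of_mem (mem_Ico.2 ⟨h1, h2⟩)]
      · filter_upwards [self_mem_nhdsWithin] with s hs
        rw [indicator_of_notMem fun hm => absurd (h2.trans_lt hs) (not_lt.2 hm.2),
          indicator_of_notMem fun hm => absurd hm.2 (not_lt.2 h2)]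
  filter_upwards [eventually_all.2 key] with s hs
  exact Finset.sum_congr rfl fun j _ => hs j

/-- Summation by intervals: as the right limit of `1_{(l, r]}` at `x` is `1_{x < r} - 1_{x < l}`, a
sum weighted by right limits reduces to partial sums of the weights. -/
theorem StepFun.sum_rightEval (h : StepFun V G) (S : Finset ℕ) (x : ℕ → ℝ≥0) (q : ℕ → V) :
    ∑ i ∈ S, h.rightEval (x i) (q i) =
      ∑ j, h.val j ((∑ i ∈ S with x i < h.right j, q i) - ∑ i ∈ S with x i < h.left j, q i) := by
  simp only [StepFun.rightEval, sum_apply]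
  rw [Finset.sum_comm]
  refine Finset.sum_congr rfl fun j _ => ?_
  rw [Finset.sum_filter, Finset.sum_filter, ← Finset.sum_sub_distrib, map_sum]
  refine Finset.sum_congr rfl fun i _ => ?_
  by_cases h1 : x i < h.left j
  · rw [indicator_of_notMem fun hm => absurd hm.1 (not_le.2 h1), if_pos h1,
      if_pos (h1.trans_le (h.left_le_right j))]
    simp
  · by_cases h2 : x i < h.right j
    · rw [indicator_of_mem (mem_Ico.2 ⟨not_lt.1 h1, h2⟩), if_neg h1, if_pos h2, sub_zero]
    · rw [indicator_of_notMem fun hm => h2 hm.2, if_neg h1, if_neg h2]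
      simp

variable {Z : ℝ≥0 → E} {π : ℕ → HalfLinePartition} {t : ℝ≥0} {H : E → V →L[ℝ] G}

/-- Continuous functions of the left limits are uniform limits of simple functions with regular
break points. -/
theorem exists_regular_stepFun (hZ : IsCadlag Z) (hC : ConditionC Z π)
    (hleft : ApproximatesFromLeft π Z) (hH : Continuous H) (ht : 0 < t) {δ : ℝ} (hδ : 0 < δ) :
    ∃ h : StepFun V G,
      (∀ j, 0 < h.right j ∧ h.right j ≤ t ∧ IsRegularPoint Z π t (h.right j)) ∧
      (∀ j, h.left j = 0 ∨ 0 < h.left j ∧ h.left j ≤ t ∧ IsRegularPoint Z π t (h.left j)) ∧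
      ∀ s ∈ Ioc 0 t, ‖h.eval s - H (leftVal Z s)‖ < δ := by
  obtain ⟨P, htP, hP, hcell⟩ := exists_regular_cells hZ hC hleft hH ht hδ
  obtain ⟨h, h1, h2⟩ := exists_stepFun htP fun s => H (leftVal Z s)
  refine ⟨h, fun j => hP _ (h1 j).1, fun j => (h1 j).2.imp_right fun hm => hP _ hm,
    fun s hs => ?_⟩
  obtain ⟨p, hp, hsp, hmin, he⟩ := h2 s hs
  rw [he, ← dist_eq_norm, dist_comm]
  exact hcell s p hs.1 hsp (hP p hp).2.1 hmin

/-- A simple function close to `H(Z_-)` has right limits close to `H(Z)`. -/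
theorem StepFun.norm_rightEval_sub_le (hZ : IsCadlag Z) (hH : Continuous H) {h : StepFun V G}
    {δ : ℝ} (hh : ∀ s ∈ Ioc 0 t, ‖h.eval s - H (leftVal Z s)‖ < δ) {r : ℝ≥0} (hr : r < t) :
    ‖h.rightEval r - H (Z r)‖ ≤ δ := by
  refine le_of_tendsto (tendsto_const_nhds.sub
    ((hH.tendsto _).comp (hZ.leftVal_tendsto_right r))).norm ?_
  filter_upwards [h.eventually_eval_eq r, Ioo_mem_nhdsGT hr] with s h1 h2
  rw [← h1]
  exact (hh s ⟨zero_le.trans_lt h2.1, h2.2.le⟩).le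

/-- If the partial sums of the weights `q` up to the element containing `p` tend to
`Q(p) - Q(0)` at every regular point `p`, in the sense of every operator into `G'`, then the
weighted sums of `H(Z)` tend to the integral of `H(Z_-)` with respect to `Q`. For `G' = G` and
`φ = id` this is norm convergence, for functionals `φ` weak convergence. -/
theorem tendsto_weighted_sum (hZ : IsCadlag Z) (hC : ConditionC Z π)
    (hleft : ApproximatesFromLeft π Z) (hH : Continuous H) (ht : 0 < t) {q : ℕ → ℕ → V} {M : ℝ}
    (hM : ∀ n, ∑ i ∈ Finset.range ((π n).bound t), ‖q n i‖ ≤ M)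
    (hq0 : ∀ n i, t ≤ (π n).pt i → q n i = 0) {Q : ℝ≥0 → V} (φ : G →L[ℝ] G')
    (hq : ∀ p, 0 < p → p ≤ t → IsRegularPoint Z π t p → ∀ T : V →L[ℝ] G',
      Tendsto (fun n => T (∑ i ∈ Finset.range ((π n).bound t) with (π n).pt i < p, q n i)) atTop
        (𝓝 (T (Q p - Q 0)))) {z : G}
    (hz : HasStieltjesIntegral (fun s => H (leftVal Z s)) Q t z) :
    Tendsto (fun n => φ (∑ i ∈ Finset.range ((π n).bound t), H (Z ((π n).pt i)) (q n i))) atTop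
      (𝓝 (φ z)) := by
  have hM0 : 0 ≤ M := (Finset.sum_nonneg fun _ _ => norm_nonneg _).trans (hM 0)
  rw [Metric.tendsto_nhds]
  intro ε hε
  set c := ‖φ‖ + 1 with hc
  have hcpos : 0 < c := by positivity
  obtain ⟨K, -, δ, hδ, hK⟩ := hz.tendsto (ε / (3 * c)) (by positivity)
  obtain ⟨h, hr, hl, hh⟩ := exists_regular_stepFun hZ hC hleft hH ht
    (lt_min hδ (show 0 < ε / (3 * c * (M + 1)) by positivity))
  have hz1 : ‖h.integral Q t - z‖ < ε / (3 * c) :=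
    hK h fun s hs => (rho_le_opNorm _ _).trans_lt ((hh s hs).trans_le (min_le_left _ _))
  have hmid : Tendsto (fun n => φ (∑ i ∈ Finset.range ((π n).bound t),
      h.rightEval ((π n).pt i) (q n i))) atTop (𝓝 (φ (h.integral Q t))) := by
    simp only [StepFun.sum_rightEval, StepFun.integral, map_sum]
    refine tendsto_finsetSum _ fun j _ => ?_
    have h1 := hq _ (hr j).1 (hr j).2.1 (hr j).2.2 (φ.comp (h.val j))
    have h2 : Tendsto (fun n => φ.comp (h.val j)
        (∑ i ∈ Finset.range ((π n).bound t) with (π n).pt i < h.left j, q n i)) atTop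
        (𝓝 (φ.comp (h.val j) (Q (h.left j) - Q 0))) := by
      rcases hl j with h0 | h0
      · simp [h0]
      · exact hq _ h0.1 h0.2.1 h0.2.2 _
    have h3 := h1.sub h2
    rw [← map_sub, sub_sub_sub_cancel_right] at h3
    have hlt : h.left j ≤ t := (h.left_le_right j).trans (hr j).2.1
    rw [min_eq_left (hr j).2.1, min_eq_left hlt]
    refine h3.congr fun n => ?_
    rw [← map_sub]; rfl
  filter_upwards [(Metric.tendsto_nhds.1 hmid) (ε / 3) (by positivity)] with n hn
  have h1 : ‖(∑ i ∈ Finset.range ((π n).bound t), H (Z ((π n).pt i)) (q n i)) -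
      ∑ i ∈ Finset.range ((π n).bound t), h.rightEval ((π n).pt i) (q n i)‖ ≤
      ε / (3 * c * (M + 1)) * M := by
    rw [← Finset.sum_sub_distrib]
    refine (norm_sum_le _ _).trans (le_trans ?_
      (mul_le_mul_of_nonneg_left (hM n) (by positivity)))
    rw [Finset.mul_sum]
    refine Finset.sum_le_sum fun i _ => ?_
    rcases le_or_gt t ((π n).pt i) with hti | hti
    · simp [hq0 n i hti]
    · rw [← sub_apply]
      refine (ContinuousLinearMap.le_opNorm _ _).trans
        (mul_le_mul_of_nonneg_right ?_ (norm_nonneg _))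
      rw [norm_sub_rev]
      exact (StepFun.norm_rightEval_sub_le hZ hH hh hti).trans (min_le_right _ _)
  have h2 : ε / (3 * c * (M + 1)) * M < ε / (3 * c) := by
    rw [div_mul_eq_mul_div, div_lt_div_iff₀ (by positivity) (by positivity)]
    have : 0 < ε * (3 * c) := by positivity
    nlinarith
  have hφ : ∀ x : G, ‖x‖ < ε / (3 * c) → ‖φ x‖ < ε / 3 := fun x hx => by
    refine (φ.le_opNorm x).trans_lt ?_
    have : c * (ε / (3 * c)) = ε / 3 := by field_simp
    rw [← this]
    have h0 : 0 ≤ ‖φ‖ := norm_nonneg _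
    have h3 : ‖φ‖ * ‖x‖ ≤ c * ‖x‖ := by rw [hc]; nlinarith [norm_nonneg x]
    exact h3.trans_lt (by gcongr)
  rw [dist_eq_norm] at hn ⊢
  have h3 := hφ _ (h1.trans_lt h2)
  have h4 := hφ _ hz1
  rw [map_sub] at h3 h4
  refine lt_of_le_of_lt (norm_sub_le_norm_sub_add_norm_sub _ (φ (∑ i ∈ Finset.range
    ((π n).bound t), h.rightEval ((π n).pt i) (q n i))) _) ?_
  have h5 := norm_sub_le_norm_sub_add_norm_sub (φ (∑ i ∈ Finset.range
    ((π n).bound t), h.rightEval ((π n).pt i) (q n i))) (φ (h.integral Q t)) (φ z)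
  linarith

end Riemann

/-! ### Partial sums of increments -/

section Partial

variable {E : Type*} [NormedAddCommGroup E]

theorem filter_pt_lt_eq (π : HalfLinePartition) {p t : ℝ≥0} (hp : 0 < p) (hpt : p ≤ t) :
    (Finset.range (π.bound t)).filter (fun i => π.pt i < p) = Finset.range (π.idx p + 1) := by
  ext i
  rw [Finset.mem_filter, Finset.mem_range, Finset.mem_range, π.pt_lt_iff hp, Nat.lt_succ_iff,
    and_iff_right_iff_imp]
  intro hi
  exact π.strictMono.lt_iff_lt.1 (((π.pt_lt_iff hp).2 hi).trans_le (hpt.trans (π.le_pt_bound t)))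

theorem sum_incr_lt (A : ℝ≥0 → E) (π : HalfLinePartition) {p t : ℝ≥0} (hp : 0 < p) (hpt : p ≤ t) :
    ∑ i ∈ Finset.range (π.bound t) with π.pt i < p, incr A π t i =
      A (min (π.upper p) t) - A 0 := by
  rw [filter_pt_lt_eq π hp hpt]
  simp only [incr]
  rw [Finset.sum_range_sub (fun i => A (min (π.pt i) t)), π.pt_zero,
    min_eq_left (zero_le : 0 ≤ t)]
  rfl

variable [NormedSpace ℝ E] {E₁ : Type*} [NormedAddCommGroup E₁] [NormedSpace ℝ E₁]

/-- The full squares up to the element containing `p` differ from the discrete quadratic variation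
at `p` in the last element only. -/
theorem sum_quad_lt (B : E →L[ℝ] E →L[ℝ] E₁) (X : ℝ≥0 → E) (π : HalfLinePartition) {p t : ℝ≥0}
    (hp : 0 < p) (hpt : p ≤ t) :
    ∑ i ∈ Finset.range (π.bound t) with π.pt i < p, B (incr X π t i) (incr X π t i) =
      discreteQuadVar B X π p +
        (B (X (min (π.upper p) t) - X (π.lower p)) (X (min (π.upper p) t) - X (π.lower p)) -
          B (X p - X (π.lower p)) (X p - X (π.lower p))) := by
  have h1 : discreteQuadVar B X π p =
      ∑ i ∈ Finset.range (π.idx p + 1), B (incr X π p i) (incr X π p i) :=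
    finsum_eq_sum_range fun i hi => by
      rw [incr_eq_zero X π ((π.le_upper hp).trans (π.strictMono.monotone hi)), map_zero]
  have hlow := (π.lower_lt hp).le
  rw [filter_pt_lt_eq π hp hpt, h1, Finset.sum_range_succ, Finset.sum_range_succ]
  have h2 : ∀ i ∈ Finset.range (π.idx p), incr X π t i = incr X π p i := fun i hi => by
    have hlt : π.pt (i + 1) < p := (π.pt_lt_iff hp).2 (Finset.mem_range.1 hi)
    have hlt' : π.pt i < p := (π.pt_lt_iff hp).2 (Finset.mem_range.1 hi).le
    rw [incr, incr, min_eq_left hlt.le, min_eq_left hlt'.le, min_eq_left (hlt.le.trans hpt),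
      min_eq_left (hlt'.le.trans hpt)]
  have h3 : incr X π t (π.idx p) = X (min (π.upper p) t) - X (π.lower p) := by
    rw [incr, show min (π.pt (π.idx p)) t = π.lower p from min_eq_left (hlow.trans hpt)]; rfl
  have h4 : incr X π p (π.idx p) = X p - X (π.lower p) := by
    rw [incr, show min (π.pt (π.idx p)) p = π.lower p from min_eq_left hlow,
      min_eq_right (show p ≤ π.pt (π.idx p + 1) from π.le_upper hp)]
  rw [Finset.sum_congr rfl fun i hi => by rw [h2 i hi], h3, h4]
  abel

end Partial

/-! ### Sums over jump times as limits of sums along the partitions -/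

section JumpSums

variable {W : Type*} [NormedAddCommGroup W] {Z : ℝ≥0 → W} {π : ℕ → HalfLinePartition} {t : ℝ≥0}

theorem leftVal_eq_of_notMem_jumpSet {s : ℝ≥0} (hs : s ∉ jumpSet Z) : leftVal Z s = Z s := by
  simp only [jumpSet, mem_ofPred_eq, not_not, norm_eq_zero, jump] at hs
  exact (sub_eq_zero.1 hs).symm

/-- Finitely many jump times eventually belong to different elements of the partitions. -/
theorem eventually_injOn_idx (hC : ConditionC Z π) (S : Finset (Ioc (0 : ℝ≥0) t))
    (hS : ∀ s ∈ S, (s : ℝ≥0) ∈ jumpSet Z) :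
    ∀ᶠ n in atTop, Set.InjOn (fun s : Ioc (0 : ℝ≥0) t => (π n).idx s) S := by
  have key : ∀ s ∈ S, ∀ s' ∈ S, ∀ᶠ n in atTop, (π n).idx s = (π n).idx s' → s = s' := by
    intro s hs s' hs'
    have hpos : ∀ r ∈ S, 0 < ‖jump Z r‖ := fun r hr =>
      lt_of_le_of_ne (norm_nonneg _) (Ne.symm (hS r hr))
    obtain ⟨N, hN⟩ := hC.c1 t _ (lt_min (hpos s hs) (hpos s' hs'))
    filter_upwards [eventually_ge_atTop N] with n hn he
    have h1 : (s : ℝ≥0) ∈ largeJumpSet (min ‖jump Z s‖ ‖jump Z s'‖) Z :=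
      min_le_left ‖jump Z s‖ ‖jump Z s'‖
    have h2 : (s' : ℝ≥0) ∈ largeJumpSet (min ‖jump Z s‖ ‖jump Z s'‖) Z :=
      min_le_right ‖jump Z s‖ ‖jump Z s'‖
    refine Subtype.ext (hN n hn ((π n).idx s)
      ⟨⟨(π n).mem_Ioc_lower_upper s.2.1, s.2.2⟩, h1⟩ ?_)
    rw [he]
    exact ⟨⟨(π n).mem_Ioc_lower_upper s'.2.1, s'.2.2⟩, h2⟩
  filter_upwards [(Filter.eventually_all_finset S).2 fun s hs =>
    (Filter.eventually_all_finset S).2 fun s' hs' => key s hs s' hs'] with n hn s hs s' hs'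
  exact hn s hs s' hs'

theorem min_pt_idx (π : HalfLinePartition) {s : ℝ≥0} (hs : s ∈ Ioc 0 t) :
    min (π.pt (π.idx s)) t = π.lower s :=
  min_eq_left ((π.lower_lt hs.1).le.trans hs.2)

theorem idx_lt_bound (π : HalfLinePartition) {s : ℝ≥0} (hs : s ∈ Ioc 0 t) :
    π.idx s < π.bound t :=
  π.strictMono.lt_iff_lt.1 (((π.lower_lt hs.1).trans_le hs.2).trans_le (π.le_pt_bound t))

theorem tendsto_sum_jump (hC : ConditionC Z π) (hleft : ApproximatesFromLeft π Z)
    {G : Type*} [NormedAddCommGroup G] {Φ : W → W → G} (hΦ : Continuous fun p : W × W => Φ p.1 p.2)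
    (S : Finset (Ioc (0 : ℝ≥0) t)) (hS : ∀ s ∈ S, (s : ℝ≥0) ∈ jumpSet Z) :
    Tendsto (fun n => ∑ s ∈ S, Φ (Z (min ((π n).pt ((π n).idx s)) t))
      (Z (min ((π n).pt ((π n).idx s + 1)) t))) atTop (𝓝 (∑ s ∈ S, Φ (leftVal Z s) (Z s))) := by
  refine tendsto_finsetSum _ fun s hs => ?_
  have h1 := hleft s s.2.1
  have h2 := isRegularPoint_of_jump hC hleft s.2.1 s.2.2 (hS s hs)
  have h3 := (hΦ.tendsto (leftVal Z s, Z s)).comp (h1.prodMk_nhds h2)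
  refine h3.congr fun n => ?_
  simp only [Function.comp_apply, min_pt_idx (π n) s.2]
  rfl

/-- Bounds of nonnegative sums along the partitions carry over to the sum over the jumps. -/
theorem sum_jump_le (hC : ConditionC Z π) (hleft : ApproximatesFromLeft π Z) {ψ : W → W → ℝ}
    (hψ : Continuous fun p : W × W => ψ p.1 p.2) (hψ0 : ∀ z w, 0 ≤ ψ z w) (hψz : ∀ z, ψ z z = 0)
    {M : ℝ} (hM : ∀ n, ∑ i ∈ Finset.range ((π n).bound t),
      ψ (Z (min ((π n).pt i) t)) (Z (min ((π n).pt (i + 1)) t)) ≤ M)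
    (S : Finset (Ioc (0 : ℝ≥0) t)) : ∑ s ∈ S, ψ (leftVal Z s) (Z s) ≤ M := by
  classical
  have h0 : ∑ s ∈ S.filter (fun s : Ioc (0 : ℝ≥0) t => (s : ℝ≥0) ∈ jumpSet Z),
      ψ (leftVal Z s) (Z s) =
      ∑ s ∈ S, ψ (leftVal Z s) (Z s) := by
    refine Finset.sum_filter_of_ne fun s _ hne => ?_
    by_contra hcon
    exact hne (by rw [leftVal_eq_of_notMem_jumpSet hcon, hψz])
  rw [← h0]
  have hS : ∀ s ∈ S.filter (fun s : Ioc (0 : ℝ≥0) t => (s : ℝ≥0) ∈ jumpSet Z),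
      (s : ℝ≥0) ∈ jumpSet Z :=
    fun s hs => (Finset.mem_filter.1 hs).2
  refine le_of_tendsto (tendsto_sum_jump hC hleft hψ _ hS) ?_
  filter_upwards [eventually_injOn_idx hC _ hS] with n hn
  refine le_trans ?_ (hM n)
  rw [← Finset.sum_image (f := fun i => ψ (Z (min ((π n).pt i) t)) (Z (min ((π n).pt (i + 1)) t)))
    hn]
  refine Finset.sum_le_sum_of_subset_of_nonneg (fun i hi => ?_) fun _ _ _ => hψ0 _ _
  obtain ⟨s, -, rfl⟩ := Finset.mem_image.1 hi
  exact Finset.mem_range.2 (idx_lt_bound (π n) s.2)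

/-- If `Φ` is `o(ψ)` on the diagonal over the range of the path, and the sums of `ψ` along the
partitions are bounded, then the sums of `Φ` along the partitions tend to the sum of `Φ` over the
jumps: the elements without large jumps contribute little, and each of the others contains one
large jump. -/
theorem exists_hasSum_jump (hZ : IsCadlag Z) (hC : ConditionC Z π)
    (hleft : ApproximatesFromLeft π Z) {ψ : W → W → ℝ}
    (hψ : Continuous fun p : W × W => ψ p.1 p.2) (hψ0 : ∀ z w, 0 ≤ ψ z w) (hψz : ∀ z, ψ z z = 0)
    {M : ℝ} (hM : ∀ n, ∑ i ∈ Finset.range ((π n).bound t),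
      ψ (Z (min ((π n).pt i) t)) (Z (min ((π n).pt (i + 1)) t)) ≤ M)
    {G : Type*} [NormedAddCommGroup G] [CompleteSpace G] {Φ : W → W → G}
    (hΦ : Continuous fun p : W × W => Φ p.1 p.2) {C : Set W} (hZC : ∀ u ≤ t, Z u ∈ C)
    (hZC' : ∀ u ≤ t, leftVal Z u ∈ C)
    (hsmall : ∀ δ > 0, ∃ η > 0, ∀ z ∈ C, ∀ w, ‖w - z‖ ≤ η → ‖Φ z w‖ ≤ δ * ψ z w) :
    ∃ J, HasSum (fun s : Ioc (0 : ℝ≥0) t => Φ (leftVal Z s) (Z s)) J ∧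
      Tendsto (fun n => ∑ i ∈ Finset.range ((π n).bound t),
        Φ (Z (min ((π n).pt i) t)) (Z (min ((π n).pt (i + 1)) t))) atTop (𝓝 J) := by
  classical
  have hM0 : 0 ≤ M := (Finset.sum_nonneg fun _ _ => hψ0 _ _).trans (hM 0)
  have hMS := sum_jump_le hC hleft hψ hψ0 hψz hM
  have hfin : ∀ ε : ℝ, 0 < ε → {s : Ioc (0 : ℝ≥0) t | (s : ℝ≥0) ∈ largeJumpSet ε Z}.Finite :=
    fun ε hε => ((hZ.finite_largeJumpSet hε t).preimage
      Subtype.val_injective.injOn).subset fun s hs => ⟨s.2, hs⟩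
  have hsum : Summable fun s : Ioc (0 : ℝ≥0) t => Φ (leftVal Z s) (Z s) := by
    obtain ⟨η, hη, h1⟩ := hsmall 1 one_pos
    refine Summable.of_norm_bounded_eventually
      (summable_of_sum_le (fun s => hψ0 _ _) hMS) ?_
    filter_upwards [(hfin η hη).compl_mem_cofinite] with s hs
    have h2 : ‖Z s - leftVal Z s‖ < η := not_le.1 hs
    simpa using h1 _ (hZC' s s.2.2) (Z s) h2.le
  obtain ⟨J, hJ⟩ := hsum
  refine ⟨J, hJ, ?_⟩
  rw [Metric.tendsto_nhds]
  intro ε hε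
  obtain ⟨η, hη, hsm⟩ := hsmall (ε / (4 * (M + 1))) (by positivity)
  have hδM : ε / (4 * (M + 1)) * M ≤ ε / 4 := by
    rw [div_mul_eq_mul_div, div_le_div_iff₀ (by positivity) (by positivity)]
    nlinarith
  obtain ⟨κ, hκ, hκη, hosc⟩ := hC.exists_osc_lt t hη
  set D := (hfin κ hκ).toFinset with hD
  have hmemD : ∀ s : Ioc (0 : ℝ≥0) t, s ∈ D ↔ (s : ℝ≥0) ∈ largeJumpSet κ Z := fun s => by
    rw [hD, Set.Finite.mem_toFinset]; rfl
  have hDjump : ∀ s ∈ D, (s : ℝ≥0) ∈ jumpSet Z := fun s hs =>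
    (hκ.trans_le ((hmemD s).1 hs)).ne'
  have htail : ‖J - ∑ s ∈ D, Φ (leftVal Z s) (Z s)‖ ≤ ε / 4 := by
    refine le_of_tendsto (hJ.sub_const _).norm ?_
    filter_upwards [eventually_ge_atTop D] with T hT
    rw [← Finset.sum_sdiff hT, add_sub_cancel_right]
    refine (norm_sum_le _ _).trans (le_trans ?_ hδM)
    refine le_trans ?_ (mul_le_mul_of_nonneg_left (hMS (T \ D)) (by positivity))
    rw [Finset.mul_sum]
    refine Finset.sum_le_sum fun s hs => hsm _ (hZC' s s.2.2) _ ?_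
    have hs' : ¬ κ ≤ ‖jump Z s‖ := fun h => (Finset.mem_sdiff.1 hs).2 ((hmemD s).2 h)
    exact (not_le.1 hs').le.trans hκη.le
  filter_upwards [hosc, eventually_injOn_idx hC D hDjump,
    (Metric.tendsto_nhds.1 (tendsto_sum_jump hC hleft hΦ D hDjump)) (ε / 4) (by positivity)]
    with n hn hinj hlim
  rw [← Finset.sum_image (f := fun i => Φ (Z (min ((π n).pt i) t)) (Z (min ((π n).pt (i + 1)) t)))
    hinj, dist_eq_norm] at hlim
  -- the elements that contain a large jump
  set I := D.image fun s : Ioc (0 : ℝ≥0) t => (π n).idx s with hI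
  have hsub : I ⊆ Finset.range ((π n).bound t) := fun i hi => by
    obtain ⟨s, -, rfl⟩ := Finset.mem_image.1 hi
    exact Finset.mem_range.2 (idx_lt_bound (π n) s.2)
  have hgood : ‖∑ i ∈ Finset.range ((π n).bound t) \ I,
      Φ (Z (min ((π n).pt i) t)) (Z (min ((π n).pt (i + 1)) t))‖ ≤ ε / 4 := by
    refine (norm_sum_le _ _).trans (le_trans ?_ hδM)
    refine le_trans ?_ (mul_le_mul_of_nonneg_left ((Finset.sum_le_sum_of_subset_of_nonneg
      (Finset.sdiff_subset (t := I)) fun _ _ _ => hψ0 _ _).trans (hM n)) (by positivity))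
    rw [Finset.mul_sum]
    refine Finset.sum_le_sum fun i hi => hsm _ (hZC _ (min_le_right _ _)) _ ?_
    refine norm_sub_le_of_osc hZ hn hη fun s hs hst hsi => (Finset.mem_sdiff.1 hi).2 ?_
    have hs0 : 0 < s := zero_le.trans_lt hsi.1
    exact Finset.mem_image.2 ⟨⟨s, hs0, hst⟩, (hmemD _).2 hs, (π n).idx_eq hsi⟩
  rw [dist_eq_norm, ← Finset.sum_sdiff hsub]
  have e : ∀ a b c d : G, a + b - d = a + (b - c) - (d - c) := fun a b c d => by abel
  rw [e _ _ (∑ s ∈ D, Φ (leftVal Z s) (Z s))]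
  refine (norm_sub_le _ _).trans_lt ?_
  linarith [norm_add_le (∑ i ∈ Finset.range ((π n).bound t) \ I,
      Φ (Z (min ((π n).pt i) t)) (Z (min ((π n).pt (i + 1)) t))) (∑ i ∈ I,
      Φ (Z (min ((π n).pt i) t)) (Z (min ((π n).pt (i + 1)) t)) -
      ∑ s ∈ D, Φ (leftVal Z s) (Z s))]

end JumpSums

/-! ### Taylor estimates for Gâteaux differentiable functions -/

/-- A continuous map is uniformly continuous near a compact set. -/
theorem exists_modulus {V Y : Type*} [NormedAddCommGroup V] [NormedAddCommGroup Y]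
    {φ : V → Y} (hφ : Continuous φ)
    {C : Set V} (hC : IsCompact C) {δ : ℝ} (hδ : 0 < δ) :
    ∃ η > 0, ∀ z ∈ C, ∀ w, ‖w - z‖ ≤ η → ‖φ w - φ z‖ ≤ δ := by
  have h := hC.uniformContinuousAt_of_continuousAt φ (fun a _ => hφ.continuousAt)
    (Metric.dist_mem_uniformity hδ)
  obtain ⟨η, hη, h1⟩ := Metric.mem_uniformity_dist.1 h
  refine ⟨η / 2, half_pos hη, fun z hz w hw => ?_⟩
  have h2 : dist z w < η := by rw [dist_comm, dist_eq_norm]; linarith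
  have h3 : dist (φ z) (φ w) < δ := h1 h2 hz
  rw [← dist_eq_norm, dist_comm]
  exact h3.le

section Taylor

variable {V G : Type*} [NormedAddCommGroup V] [NormedSpace ℝ V]
  [NormedAddCommGroup G] [NormedSpace ℝ G] {g : V → G} {L : V → V →L[ℝ] G}

theorem HasGateauxDerivAt.hasDerivAt_line {x h : V} {θ : ℝ} {T : V →L[ℝ] G}
    (hg : HasGateauxDerivAt g T (x + θ • h)) : HasDerivAt (fun s : ℝ => g (x + s • h)) (T h) θ := by
  rw [hasDerivAt_iff_tendsto_slope_zero]
  refine (hg h).congr fun s => ?_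
  rw [add_smul, add_assoc]

/-- The mean value inequality along the segment from `x` to `x + h`. -/
theorem norm_sub_sub_le_of_gateaux (hg : ∀ x, HasGateauxDerivAt g (L x) x) {x h : V}
    {T : V →L[ℝ] G} {c : ℝ} (hc : ∀ θ ∈ Icc (0 : ℝ) 1, ‖L (x + θ • h) - T‖ ≤ c) :
    ‖g (x + h) - g x - T h‖ ≤ c * ‖h‖ := by
  have h1 : ∀ θ : ℝ, HasDerivAt (fun s : ℝ => g (x + s • h) - s • T h)
      (L (x + θ • h) h - T h) θ := fun θ => by
    simpa using (hg (x + θ • h)).hasDerivAt_line.fun_sub ((hasDerivAt_id θ).smul_const (T h))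
  have h2 := norm_image_sub_le_of_norm_deriv_le_segment_01' (C := c * ‖h‖)
    (fun θ _ => (h1 θ).hasDerivWithinAt) fun θ hθ => by
      rw [← sub_apply]
      exact ((L (x + θ • h) - T).le_opNorm h).trans
        (mul_le_mul_of_nonneg_right (hc θ ⟨hθ.1, hθ.2.le⟩) (norm_nonneg _))
  simp only [one_smul, zero_smul, add_zero, sub_zero] at h2
  rwa [sub_right_comm] at h2

/-- The second order Taylor estimate, by the mean value inequality applied twice along the segment
from `x` to `x + h`. -/
theorem norm_sub_sub_sub_le_of_gateaux {D : V → V →L[ℝ] V →L[ℝ] G}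
    (hg : ∀ x, HasGateauxDerivAt g (L x) x) (hL : ∀ x, HasGateauxDerivAt L (D x) x) {x h : V}
    {y : G} {c : ℝ} (hc : ∀ θ ∈ Icc (0 : ℝ) 1, ‖D (x + θ • h) h h - y‖ ≤ c) :
    ‖g (x + h) - g x - L x h - (1 / 2 : ℝ) • y‖ ≤ c := by
  have hc0 : 0 ≤ c := (norm_nonneg _).trans (hc 0 ⟨le_rfl, zero_le_one⟩)
  have h1 : ∀ θ : ℝ, HasDerivAt (fun s : ℝ => L (x + s • h) h - s • y)
      (D (x + θ • h) h h - y) θ := fun θ => by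
    have h2 := (hL (x + θ • h)).hasDerivAt_line.clm_apply (hasDerivAt_const θ h)
    simpa using h2.fun_sub ((hasDerivAt_id θ).smul_const y)
  have h2 : ∀ θ ∈ Icc (0 : ℝ) 1, ‖L (x + θ • h) h - θ • y - L x h‖ ≤ c := fun θ hθ => by
    have h3 := norm_image_sub_le_of_norm_deriv_le_segment' (C := c) (a := 0) (b := 1)
      (fun θ _ => (h1 θ).hasDerivWithinAt) (fun θ hθ => hc θ ⟨hθ.1, hθ.2.le⟩) θ hθ
    simp only [zero_smul, add_zero, sub_zero] at h3
    exact h3.trans (mul_le_of_le_one_right hc0 hθ.2)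
  have h4 : ∀ θ : ℝ, HasDerivAt (fun s : ℝ => g (x + s • h) - s • L x h - (s ^ 2 / 2) • y)
      (L (x + θ • h) h - L x h - θ • y) θ := fun θ => by
    have h5 : HasDerivAt (fun s : ℝ => s ^ 2 / 2) θ θ := by
      have := ((hasDerivAt_id θ).pow 2).div_const 2
      simpa using this
    simpa using ((hg (x + θ • h)).hasDerivAt_line.fun_sub
      ((hasDerivAt_id θ).smul_const (L x h))).fun_sub (h5.smul_const y)
  have h6 := norm_image_sub_le_of_norm_deriv_le_segment_01' (C := c)
    (fun θ _ => (h4 θ).hasDerivWithinAt) fun θ hθ => by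
      rw [sub_right_comm]
      exact h2 θ ⟨hθ.1, hθ.2.le⟩
  simp only [one_smul, zero_smul, add_zero, sub_zero] at h6
  refine le_of_eq_of_le (congrArg _ ?_) h6
  simp
  abel

end Taylor

theorem norm_smul_le_of_mem_Icc {V : Type*} [NormedAddCommGroup V] [NormedSpace ℝ V]
    {θ : ℝ} (hθ : θ ∈ Icc (0 : ℝ) 1) (y : V) : ‖θ • y‖ ≤ ‖y‖ := by
  rw [norm_smul, Real.norm_of_nonneg hθ.1]
  exact mul_le_of_le_one_left (norm_nonneg _) hθ.2

/-- First order estimate in the first variable, uniformly in the second. -/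
theorem norm_fst_sub_le {E F G : Type*} [NormedAddCommGroup E]
    [NormedAddCommGroup F] [NormedSpace ℝ F] [NormedAddCommGroup G] [NormedSpace ℝ G]
    {f : F × E → G} {Daf : F × E → F →L[ℝ] G}
    (hDaf : ∀ a x, HasGateauxDerivAt (fun a' => f (a', x)) (Daf (a, x)) a)
    {z w : F × E} {η δ : ℝ} (hη : ∀ v, ‖v - z‖ ≤ η → ‖Daf v - Daf z‖ ≤ δ) (hw : ‖w - z‖ ≤ η) :
    ‖f w - f (z.1, w.2) - Daf z (w.1 - z.1)‖ ≤ δ * ‖w.1 - z.1‖ := by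
  have h := norm_sub_sub_le_of_gateaux (g := fun a' => f (a', w.2)) (L := fun a' => Daf (a', w.2))
    (fun a => hDaf a w.2) (x := z.1) (h := w.1 - z.1) (T := Daf z) (c := δ) fun θ hθ => by
      refine hη _ (le_trans ?_ hw)
      simp only [Prod.norm_def, Prod.fst_sub, Prod.snd_sub, add_sub_cancel_left]
      exact max_le_max (norm_smul_le_of_mem_Icc hθ _) le_rfl
  simpa using h

section TwoVariables

variable {E E₁ F G : Type*}
  [NormedAddCommGroup E] [NormedSpace ℝ E] [NormedAddCommGroup E₁] [NormedSpace ℝ E₁]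
  [NormedAddCommGroup F] [NormedSpace ℝ F] [NormedAddCommGroup G] [NormedSpace ℝ G]
  {f : F × E → G} {Daf : F × E → F →L[ℝ] G} {Dxf : F × E → E →L[ℝ] G}

/-- Joint continuity from partial Gâteaux derivatives that are locally bounded. -/
theorem continuous_of_gateaux
    (hDaf : ∀ a x, HasGateauxDerivAt (fun a' => f (a', x)) (Daf (a, x)) a)
    (hDxf : ∀ a x, HasGateauxDerivAt (fun x' => f (a, x')) (Dxf (a, x)) x)
    (hca : Continuous Daf) (hcx : Continuous Dxf) : Continuous f := by
  rw [continuous_iff_continuousAt]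
  intro z
  obtain ⟨η, hη, h1⟩ := exists_modulus hca (isCompact_singleton (x := z)) one_pos
  obtain ⟨η', hη', h2⟩ := exists_modulus hcx (isCompact_singleton (x := z)) one_pos
  have hle : ∀ᶠ w in 𝓝 z, ‖f w - f z‖ ≤
      1 * ‖w.1 - z.1‖ + ‖Daf z (w.1 - z.1)‖ + (1 * ‖w.2 - z.2‖ + ‖Dxf z (w.2 - z.2)‖) := by
    filter_upwards [Metric.closedBall_mem_nhds z (lt_min hη hη')] with w hw
    rw [Metric.mem_closedBall, dist_eq_norm] at hw
    have h3 := norm_fst_sub_le hDaf (h1 z rfl) (hw.trans (min_le_left _ _))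
    have h4 := norm_sub_sub_le_of_gateaux (g := fun x' => f (z.1, x'))
      (L := fun x' => Dxf (z.1, x')) (fun x => hDxf z.1 x) (x := z.2) (h := w.2 - z.2)
      (T := Dxf z) (c := 1) fun θ hθ => by
        refine h2 z rfl _ (le_trans ?_ (hw.trans (min_le_right _ _)))
        simp only [Prod.norm_def, Prod.fst_sub, Prod.snd_sub, add_sub_cancel_left, sub_self,
          norm_zero]
        exact max_le_max (norm_nonneg _) (norm_smul_le_of_mem_Icc hθ _)
    simp only [add_sub_cancel] at h4
    have e : f w - f z = (f w - f (z.1, w.2) - Daf z (w.1 - z.1)) + Daf z (w.1 - z.1) +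
        ((f (z.1, w.2) - f (z.1, z.2) - Dxf z (w.2 - z.2)) + Dxf z (w.2 - z.2)) := by abel
    rw [e]
    refine (norm_add_le _ _).trans (add_le_add ?_ ?_)
    · exact (norm_add_le _ _).trans (add_le_add h3 le_rfl)
    · exact (norm_add_le _ _).trans (add_le_add h4 le_rfl)
  refine tendsto_iff_norm_sub_tendsto_zero.2 (squeeze_zero' (Eventually.of_forall fun _ =>
    norm_nonneg _) hle ?_)
  have hcont : Continuous fun w : F × E =>
      1 * ‖w.1 - z.1‖ + ‖Daf z (w.1 - z.1)‖ + (1 * ‖w.2 - z.2‖ + ‖Dxf z (w.2 - z.2)‖) := by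
    fun_prop
  simpa using hcont.tendsto z

/-- The remainder at `w` of the Taylor expansion of `f` about `z`, of first order in the first
variable and of second order in the second one. -/
noncomputable def taylorRemainder (B : E →L[ℝ] E →L[ℝ] E₁) (f : F × E → G)
    (Daf : F × E → F →L[ℝ] G) (Dxf : F × E → E →L[ℝ] G) (DBf : F × E → E₁ →L[ℝ] G)
    (z w : F × E) : G :=
  f w - f z - Dxf z (w.2 - z.2) - Daf z (w.1 - z.1) -
    (1 / 2 : ℝ) • DBf z (B (w.2 - z.2) (w.2 - z.2))

variable {B : E →L[ℝ] E →L[ℝ] E₁} {DBf : F × E → E₁ →L[ℝ] G}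

theorem continuous_taylorRemainder (hf : Continuous f) (hDaf : Continuous Daf)
    (hDxf : Continuous Dxf) (hDBf : Continuous DBf) :
    Continuous fun p : (F × E) × (F × E) => taylorRemainder B f Daf Dxf DBf p.1 p.2 := by
  unfold taylorRemainder
  fun_prop

/-- The Taylor remainder is small of first order in the first variable and of second order in the
second one, uniformly near compact sets. -/
theorem exists_taylorRemainder_le
    (hDaf : ∀ a x, HasGateauxDerivAt (fun a' => f (a', x)) (Daf (a, x)) a)
    (hDxf : ∀ a x, HasGateauxDerivAt (fun x' => f (a, x')) (Dxf (a, x)) x)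
    {D2xf : F × E → E →L[ℝ] E →L[ℝ] G}
    (hD2xf : ∀ a x, HasGateauxDerivAt (fun x' => Dxf (a, x')) (D2xf (a, x)) x)
    (hDBf : ∀ z h k, D2xf z h k = DBf z (B h k))
    (hca : Continuous Daf) (hcB : Continuous DBf) {C : Set (F × E)} (hC : IsCompact C)
    {δ : ℝ} (hδ : 0 < δ) :
    ∃ η > 0, ∀ z ∈ C, ∀ w, ‖w - z‖ ≤ η →
      ‖taylorRemainder B f Daf Dxf DBf z w‖ ≤ δ * (‖w.1 - z.1‖ + ‖w.2 - z.2‖ ^ 2) := by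
  obtain ⟨η, hη, h1⟩ := exists_modulus hca hC hδ
  obtain ⟨η', hη', h2⟩ := exists_modulus hcB hC (show 0 < δ / (‖B‖ + 1) by positivity)
  refine ⟨min η η', lt_min hη hη', fun z hz w hw => ?_⟩
  have h3 := norm_fst_sub_le hDaf (h1 z hz) (hw.trans (min_le_left _ _))
  have h4 := norm_sub_sub_sub_le_of_gateaux (g := fun x' => f (z.1, x'))
    (L := fun x' => Dxf (z.1, x')) (D := fun x' => D2xf (z.1, x')) (fun x => hDxf z.1 x)
    (fun x => hD2xf z.1 x) (x := z.2) (h := w.2 - z.2) (y := DBf z (B (w.2 - z.2) (w.2 - z.2)))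
    (c := δ * ‖w.2 - z.2‖ ^ 2) fun θ hθ => by
      rw [hDBf, ← sub_apply]
      have h5 : ‖DBf (z.1, z.2 + θ • (w.2 - z.2)) - DBf z‖ ≤ δ / (‖B‖ + 1) := by
        refine h2 z hz _ (le_trans ?_ (hw.trans (min_le_right _ _)))
        simp only [Prod.norm_def, Prod.fst_sub, Prod.snd_sub, add_sub_cancel_left, sub_self,
          norm_zero]
        exact max_le_max (norm_nonneg _) (norm_smul_le_of_mem_Icc hθ _)
      have h6 : ‖B (w.2 - z.2) (w.2 - z.2)‖ ≤ (‖B‖ + 1) * ‖w.2 - z.2‖ ^ 2 := by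
        refine (B.le_opNorm₂ _ _).trans ?_
        rw [mul_assoc, ← sq]
        gcongr
        linarith
      refine (ContinuousLinearMap.le_opNorm _ _).trans ((mul_le_mul h5 h6 (norm_nonneg _)
        (by positivity)).trans (le_of_eq ?_))
      field_simp
  simp only [add_sub_cancel] at h4
  have e : taylorRemainder B f Daf Dxf DBf z w = (f w - f (z.1, w.2) - Daf z (w.1 - z.1)) +
      (f (z.1, w.2) - f (z.1, z.2) - Dxf (z.1, z.2) (w.2 - z.2) -
        (1 / 2 : ℝ) • DBf z (B (w.2 - z.2) (w.2 - z.2))) := by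
    rw [taylorRemainder]; abel
  rw [e, mul_add]
  exact (norm_add_le _ _).trans (add_le_add h3 h4)

end TwoVariables

/-! ### The Itô formula -/

section Bounds

variable {E : Type*} [NormedAddCommGroup E] {π : ℕ → HalfLinePartition} {t : ℝ≥0}

theorem incr_zero {X : ℝ≥0 → E} (π : HalfLinePartition) (i : ℕ) : incr X π 0 i = 0 :=
  incr_eq_zero X π zero_le

theorem HasFiniteTwoVariation.exists_bound {X : ℝ≥0 → E} {π : ℕ → HalfLinePartition}
    (hX : HasFiniteTwoVariation X π) (t : ℝ≥0) :
    ∃ M : ℝ, 0 ≤ M ∧ ∀ n (S : Finset ℕ), ∑ i ∈ S, ‖incr X (π n) t i‖ ^ 2 ≤ M := by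
  refine ⟨(⨆ n, ∑' i, ‖incr X (π n) t i‖ₑ ^ 2).toReal, ENNReal.toReal_nonneg, fun n S => ?_⟩
  have h1 : ∑ i ∈ S, ‖incr X (π n) t i‖ₑ ^ 2 ≤ ⨆ n, ∑' i, ‖incr X (π n) t i‖ₑ ^ 2 :=
    (ENNReal.sum_le_tsum S).trans (le_iSup (fun n => ∑' i, ‖incr X (π n) t i‖ₑ ^ 2) n)
  have h2 := ENNReal.toReal_mono (hX t).ne h1
  rw [ENNReal.toReal_sum fun i _ => by finiteness] at h2
  simpa using h2

theorem exists_incr_bound {A : ℝ≥0 → E} (hA : LocallyBoundedVariationOn A univ)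
    (π : ℕ → HalfLinePartition) (t : ℝ≥0) :
    ∃ V : ℝ, 0 ≤ V ∧ ∀ n, ∑ i ∈ Finset.range ((π n).bound t), ‖incr A (π n) t i‖ ≤ V := by
  obtain ⟨V, hV0, hV⟩ := exists_variation_bound hA t
  exact ⟨V, hV0, fun n => hV (fun i => min ((π n).pt i) t)
    (fun i j hij => min_le_min_right t ((π n).strictMono.monotone hij))
    (fun i => min_le_right _ _) _⟩

theorem tendsto_sum_incr_lt (A : ℝ≥0 → E) {p : ℝ≥0} (hp : 0 < p) (hpt : p ≤ t)
    (hreg : IsRegularPoint A π t p) :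
    Tendsto (fun n => ∑ i ∈ Finset.range ((π n).bound t) with (π n).pt i < p, incr A (π n) t i)
      atTop (𝓝 (A p - A 0)) := by
  refine (hreg.sub_const (A 0)).congr fun n => ?_
  rw [sum_incr_lt A (π n) hp hpt]

theorem summable_apply_jump {W V G : Type*} [NormedAddCommGroup W] [CompleteSpace W]
    [NormedAddCommGroup V] [NormedSpace ℝ V]
    [NormedAddCommGroup G] [NormedSpace ℝ G] [CompleteSpace G]
    {Z : ℝ≥0 → W} (hZ : IsCadlag Z) {H : W → V →L[ℝ] G} (hH : Continuous H)
    {j : ℝ≥0 → V} (hj : Summable fun s : Ioc (0 : ℝ≥0) t => ‖j s‖) :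
    Summable fun s : Ioc (0 : ℝ≥0) t => H (leftVal Z s) (j s) := by
  obtain ⟨C, hC, -, hCZ⟩ := hZ.exists_compact t
  obtain ⟨c, hc⟩ := hC.exists_bound_of_continuousOn hH.continuousOn
  refine Summable.of_norm_bounded (hj.mul_left c) fun s => ?_
  exact ((H _).le_opNorm _).trans (mul_le_mul_of_nonneg_right (hc _ (hCZ _ s.2.2)) (norm_nonneg _))

end Bounds

section Ito

variable {E E₁ F G : Type*}
  [NormedAddCommGroup E] [NormedSpace ℝ E] [NormedAddCommGroup E₁] [NormedSpace ℝ E₁]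
  [NormedAddCommGroup F] [NormedSpace ℝ F] [NormedAddCommGroup G] [NormedSpace ℝ G]

theorem hasStieltjesIntegral_at_zero (g : ℝ≥0 → E →L[ℝ] G) (A : ℝ≥0 → E) :
    HasStieltjesIntegral g A 0 0 := by
  refine ⟨fun K _ δ _ => ⟨⟨0, Fin.elim0, Fin.elim0, fun j => j.elim0, fun j => j.elim0, Fin.elim0⟩,
    fun s hs => absurd (hs.1.trans_le hs.2) (lt_irrefl _)⟩,
    fun ε hε => ⟨∅, isCompact_empty, 1, one_pos, fun h _ => ?_⟩⟩
  simpa [StepFun.integral] using hε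

variable {A : ℝ≥0 → F} {X : ℝ≥0 → E} {π : ℕ → HalfLinePartition} {t : ℝ≥0}
  {B : E →L[ℝ] E →L[ℝ] E₁}

theorem norm_quad_le (B : E →L[ℝ] E →L[ℝ] E₁) (x : E) : ‖B x x‖ ≤ ‖B‖ * ‖x‖ ^ 2 := by
  rw [sq, ← mul_assoc]
  exact B.le_opNorm₂ x x

/-- At a regular point `p` the full squares up to the element containing `p` have the same limit
as the discrete quadratic variation at `p`, as the increments of `X` from the left end point of
that element to `p` and to its right end point both tend to the jump at `p`. -/
theorem tendsto_sum_quad_lt (hleft : ApproximatesFromLeft π X) {G' : Type*} [NormedAddCommGroup G']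
    [NormedSpace ℝ G'] {T : E₁ →L[ℝ] G'} {Q : ℝ≥0 → E₁}
    (hT : ∀ s, Tendsto (fun n => T (discreteQuadVar B X (π n) s)) atTop (𝓝 (T (Q s))))
    {p : ℝ≥0} (hp : 0 < p) (hpt : p ≤ t) (hreg : IsRegularPoint X π t p) :
    Tendsto (fun n => T (∑ i ∈ Finset.range ((π n).bound t) with (π n).pt i < p,
      B (incr X (π n) t i) (incr X (π n) t i))) atTop (𝓝 (T (Q p - Q 0))) := by
  have h0 : T (Q 0) = 0 := by
    refine tendsto_nhds_unique (hT 0) ?_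
    simp [discreteQuadVar, incr_zero]
  have h1 := hleft p hp
  have h2 : Tendsto (fun n => X (min ((π n).upper p) t) - X ((π n).lower p)) atTop
      (𝓝 (X p - leftVal X p)) := hreg.sub h1
  have h3 : Tendsto (fun n => X p - X ((π n).lower p)) atTop (𝓝 (X p - leftVal X p)) :=
    tendsto_const_nhds.sub h1
  have hB : Continuous fun x : E => B x x := by fun_prop
  have h4 := (T.continuous.tendsto _).comp
    (((hB.tendsto _).comp h2).sub ((hB.tendsto _).comp h3))
  have h5 := (hT p).add h4
  rw [sub_self, map_zero, add_zero] at h5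
  rw [map_sub, h0, sub_zero]
  refine h5.congr fun n => ?_
  rw [sum_quad_lt B X (π n) hp hpt, map_add]
  rfl

/-- Telescoping of the Taylor expansions over the elements of a partition. -/
theorem sum_taylorRemainder (f : F × E → G) (Daf : F × E → F →L[ℝ] G) (Dxf : F × E → E →L[ℝ] G)
    (DBf : F × E → E₁ →L[ℝ] G) (P : HalfLinePartition) :
    ∑ i ∈ Finset.range (P.bound t), taylorRemainder B f Daf Dxf DBf
        (A (min (P.pt i) t), X (min (P.pt i) t))
        (A (min (P.pt (i + 1)) t), X (min (P.pt (i + 1)) t)) =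
      f (A t, X t) - f (A 0, X 0) - leftRiemannSum (fun s => Dxf (A s, X s)) X P t -
        (∑ i ∈ Finset.range (P.bound t), Daf (A (P.pt i), X (P.pt i)) (incr A P t i)) -
        (1 / 2 : ℝ) • ∑ i ∈ Finset.range (P.bound t),
          DBf (A (P.pt i), X (P.pt i)) (B (incr X P t i) (incr X P t i)) := by
  have h1 := Finset.sum_range_sub (fun i => f (A (min (P.pt i) t), X (min (P.pt i) t))) (P.bound t)
  rw [min_eq_right (P.le_pt_bound t), P.pt_zero, min_eq_left (zero_le : 0 ≤ t)] at h1
  rw [← h1, leftRiemannSum_eq, Finset.smul_sum, ← Finset.sum_sub_distrib,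
    ← Finset.sum_sub_distrib, ← Finset.sum_sub_distrib]
  refine Finset.sum_congr rfl fun i _ => ?_
  rcases le_or_gt t (P.pt i) with h | h
  · have h' : t ≤ P.pt (i + 1) := h.trans (P.strictMono (Nat.lt_succ_self i)).le
    simp [taylorRemainder, incr, min_eq_right h, min_eq_right h']
  · simp only [taylorRemainder, incr, min_eq_left h.le]

/-- The left Riemann sums converge, under an operator `φ` out of `G`, if the discrete quadratic
variation converges under all operators into the target of `φ`. -/
theorem tendsto_leftRiemannSum (hAX : IsCadlag fun t => (A t, X t))
    (hC : ConditionC (fun t => (A t, X t)) π)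
    (hleft : ApproximatesFromLeft π fun t => (A t, X t)) {Q : ℝ≥0 → E₁}
    (hX : HasFiniteTwoVariation X π) (hA : LocallyBoundedVariationOn A univ)
    {f : F × E → G} {Daf : F × E → F →L[ℝ] G} (hca : Continuous Daf) {Dxf : F × E → E →L[ℝ] G}
    {DBf : F × E → E₁ →L[ℝ] G} (hcB : Continuous DBf) (ht : 0 < t) {zA zQ JR : G}
    (hzA : HasStieltjesIntegral (fun s => Daf (leftVal (fun t => (A t, X t)) s)) A t zA)
    (hzQ : HasStieltjesIntegral (fun s => DBf (leftVal (fun t => (A t, X t)) s)) Q t zQ)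
    (hJR : Tendsto (fun n => ∑ i ∈ Finset.range ((π n).bound t), taylorRemainder B f Daf Dxf DBf
      (A (min ((π n).pt i) t), X (min ((π n).pt i) t))
      (A (min ((π n).pt (i + 1)) t), X (min ((π n).pt (i + 1)) t))) atTop (𝓝 JR))
    {G' : Type*} [NormedAddCommGroup G'] [NormedSpace ℝ G'] (φ : G →L[ℝ] G')
    (hT : ∀ (T : E₁ →L[ℝ] G') s, Tendsto (fun n => T (discreteQuadVar B X (π n) s)) atTop
      (𝓝 (T (Q s)))) :
    Tendsto (fun n => φ (leftRiemannSum (fun s => Dxf (A s, X s)) X (π n) t)) atTop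
      (𝓝 (φ (f (A t, X t) - f (A 0, X 0) - JR - zA - (1 / 2 : ℝ) • zQ))) := by
  obtain ⟨M, -, hM⟩ := hX.exists_bound t
  obtain ⟨V, -, hV⟩ := exists_incr_bound hA π t
  have hreg : ∀ p, IsRegularPoint (fun t => (A t, X t)) π t p →
      IsRegularPoint A π t p ∧ IsRegularPoint X π t p := fun p hp =>
    ⟨(continuous_fst.tendsto _).comp hp, (continuous_snd.tendsto _).comp hp⟩
  have hleftX : ApproximatesFromLeft π X := fun s hs => by
    have h := (continuous_snd.tendsto _).comp (hleft s hs)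
    rw [leftVal_prodMk hAX] at h
    exact h
  have hlimA := tendsto_weighted_sum hAX hC hleft hca ht hV
    (fun n i hi => incr_eq_zero A (π n) hi) φ
    (fun p hp hpt hr T => (T.continuous.tendsto _).comp
      (tendsto_sum_incr_lt A hp hpt (hreg p hr).1)) hzA
  have hlimQ := tendsto_weighted_sum hAX hC hleft hcB ht
    (q := fun n i => B (incr X (π n) t i) (incr X (π n) t i)) (M := ‖B‖ * M)
    (fun n => (Finset.sum_le_sum fun i _ => norm_quad_le B _).trans (by
      rw [← Finset.mul_sum]
      exact mul_le_mul_of_nonneg_left (hM n _) (norm_nonneg B)))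
    (fun n i hi => by rw [incr_eq_zero X (π n) hi, map_zero]) φ
    (fun p hp hpt hr T => tendsto_sum_quad_lt hleftX (hT T) hp hpt (hreg p hr).2) hzQ
  have hlim := (((tendsto_const_nhds (x := φ (f (A t, X t) - f (A 0, X 0)))).sub
    ((φ.continuous.tendsto _).comp hJR)).sub hlimA).sub (hlimQ.const_smul (1 / 2 : ℝ))
  rw [← map_smul, ← map_sub, ← map_sub, ← map_sub] at hlim
  refine hlim.congr fun n => ?_
  simp only [Function.comp_apply]
  rw [sum_taylorRemainder f Daf Dxf DBf (π n), ← map_smul, ← map_sub, ← map_sub, ← map_sub]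
  congr 1
  abel

variable [CompleteSpace E] [CompleteSpace E₁] [CompleteSpace F] [CompleteSpace G]

/-- The Itô formula at a fixed time. The Taylor remainders sum up to the jump terms less the jump
parts of the integrals with respect to `A` and `Q`, which turns these into integrals with respect
to the continuous parts. -/
theorem exists_ito (hAX : IsCadlag fun t => (A t, X t))
    (hC : ConditionC (fun t => (A t, X t)) π)
    (hleft : ApproximatesFromLeft π fun t => (A t, X t))
    {Q : ℝ≥0 → E₁} (hQc : IsCadlag Q) (hQv : LocallyBoundedVariationOn Q univ)
    (hQj : ∀ t, jump Q t = B (jump X t) (jump X t))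
    (hX : HasFiniteTwoVariation X π) (hA : LocallyBoundedVariationOn A univ)
    {f : F × E → G} {Daf : F × E → F →L[ℝ] G}
    (hDaf : ∀ a x, HasGateauxDerivAt (fun a' => f (a', x)) (Daf (a, x)) a)
    (hca : Continuous Daf) {Dxf : F × E → E →L[ℝ] G}
    (hDxf : ∀ a x, HasGateauxDerivAt (fun x' => f (a, x')) (Dxf (a, x)) x)
    {D2xf : F × E → E →L[ℝ] E →L[ℝ] G}
    (hD2xf : ∀ a x, HasGateauxDerivAt (fun x' => Dxf (a, x')) (D2xf (a, x)) x)
    (hcx : Continuous Dxf) {DBf : F × E → E₁ →L[ℝ] G}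
    (hDBf : ∀ z h k, D2xf z h k = DBf z (B h k)) (hcB : Continuous DBf) (t : ℝ≥0) :
    ∃ SA SQ J : G,
      HasStieltjesIntegral (fun s => Daf (leftVal A s, leftVal X s)) (contPart A) t SA ∧
      HasStieltjesIntegral (fun s => DBf (leftVal A s, leftVal X s)) (contPart Q) t SQ ∧
      HasSum (fun s : Ioc (0 : ℝ≥0) t =>
        f (A s, X s) - f (leftVal A s, leftVal X s)
          - Dxf (leftVal A s, leftVal X s) (jump X s)) J ∧
      (HasWeakQuadVar B X π Q → HasWeakItoFollmerIntegral (fun s => Dxf (A s, X s)) X π t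
        (f (A t, X t) - f (A 0, X 0) - SA - (1 / 2 : ℝ) • SQ - J)) ∧
      (HasStrongQuadVar B X π Q → HasItoFollmerIntegral (fun s => Dxf (A s, X s)) X π t
        (f (A t, X t) - f (A 0, X 0) - SA - (1 / 2 : ℝ) • SQ - J)) := by
  rcases eq_or_lt_of_le (zero_le : 0 ≤ t) with rfl | ht
  · have : IsEmpty (Ioc (0 : ℝ≥0) 0) := by simp
    refine ⟨0, 0, 0, hasStieltjesIntegral_at_zero _ _, hasStieltjesIntegral_at_zero _ _,
      hasSum_empty, fun _ => ?_, fun _ => ?_⟩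
    · simp [HasWeakItoFollmerIntegral, WeakTendsto, leftRiemannSum, incr_zero]
    · simp [HasItoFollmerIntegral, leftRiemannSum, incr_zero]
  have hlv : ∀ s, leftVal (fun t => (A t, X t)) s = (leftVal A s, leftVal X s) :=
    leftVal_prodMk hAX
  obtain ⟨M, -, hM⟩ := hX.exists_bound t
  obtain ⟨V, -, hVn⟩ := exists_incr_bound hA π t
  -- the weight that dominates the Taylor remainder
  set ψ : F × E → F × E → ℝ := fun z w => ‖w.1 - z.1‖ + ‖w.2 - z.2‖ ^ 2 with hψdef
  have hψ : Continuous fun p : (F × E) × (F × E) => ψ p.1 p.2 := by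
    simp only [hψdef]; fun_prop
  have hψ0 : ∀ z w, 0 ≤ ψ z w := fun z w => by simp only [hψdef]; positivity
  have hψz : ∀ z, ψ z z = 0 := fun z => by simp [hψdef]
  have hψM : ∀ n, ∑ i ∈ Finset.range ((π n).bound t),
      ψ (A (min ((π n).pt i) t), X (min ((π n).pt i) t))
        (A (min ((π n).pt (i + 1)) t), X (min ((π n).pt (i + 1)) t)) ≤ V + M := fun n => by
    simp only [hψdef]
    rw [Finset.sum_add_distrib]
    exact add_le_add (hVn n) (hM n _)
  have hψsum : Summable fun s : Ioc (0 : ℝ≥0) t => ‖jump A s‖ + ‖jump X s‖ ^ 2 := by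
    refine summable_of_sum_le (c := V + M) (fun s => by positivity) fun S => ?_
    have h := sum_jump_le hC hleft hψ hψ0 hψz hψM S
    simpa only [hlv, hψdef, jump] using h
  have hAj : Summable fun s : Ioc (0 : ℝ≥0) t => ‖jump A s‖ :=
    Summable.of_nonneg_of_le (fun _ => norm_nonneg _)
      (fun s => le_add_of_nonneg_right (by positivity)) hψsum
  have hQj' : Summable fun s : Ioc (0 : ℝ≥0) t => ‖jump Q s‖ := by
    refine Summable.of_nonneg_of_le (fun _ => norm_nonneg _) (fun s => ?_) (hψsum.mul_left ‖B‖)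
    rw [hQj]
    refine (norm_quad_le B _).trans (mul_le_mul_of_nonneg_left ?_ (norm_nonneg B))
    exact le_add_of_nonneg_left (norm_nonneg _)
  -- the integrals with respect to `A` and `Q` and their continuous parts
  obtain ⟨zA, hzA⟩ := exists_hasStieltjesIntegral (t := t) hAX.fst hA
    (g := fun s => Daf (leftVal (fun t => (A t, X t)) s)) fun δ hδ => by
      obtain ⟨h, -, -, h1⟩ := exists_regular_stepFun hAX hC hleft hca ht hδ
      exact ⟨h, h1⟩
  obtain ⟨zQ, hzQ⟩ := exists_hasStieltjesIntegral (t := t) hQc hQv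
    (g := fun s => DBf (leftVal (fun t => (A t, X t)) s)) fun δ hδ => by
      obtain ⟨h, -, -, h1⟩ := exists_regular_stepFun hAX hC hleft hcB ht hδ
      exact ⟨h, h1⟩
  obtain ⟨yA, hyA⟩ := summable_apply_jump hAX hca hAj
  obtain ⟨yQ, hyQ⟩ := summable_apply_jump hAX hcB hQj'
  -- the sum of the Taylor remainders over the jumps
  obtain ⟨C, hCc, hC1, hC2⟩ := hAX.exists_compact t
  have hf := continuous_of_gateaux hDaf hDxf hca hcx
  obtain ⟨JR, hJR, hlimR⟩ := exists_hasSum_jump hAX hC hleft hψ hψ0 hψz hψM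
    (Φ := taylorRemainder B f Daf Dxf DBf) (continuous_taylorRemainder hf hca hcx hcB) hC1 hC2
    fun δ hδ => exists_taylorRemainder_le hDaf hDxf hD2xf hDBf hca hcB hCc hδ
  have hSA := hzA.contPart hAX.fst hAj hyA
  have hSQ := hzQ.contPart hQc hQj' hyQ
  simp only [hlv] at hSA hSQ hJR hyA hyQ
  -- the jump parts `yA` and `yQ` cancel between the integrals and the sum over the jumps
  have e : f (A t, X t) - f (A 0, X 0) - JR - zA - (1 / 2 : ℝ) • zQ =
      f (A t, X t) - f (A 0, X 0) - (zA - yA) - (1 / 2 : ℝ) • (zQ - yQ) -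
        (JR + yA + (1 / 2 : ℝ) • yQ) := by
    rw [smul_sub]; abel
  refine ⟨zA - yA, zQ - yQ, JR + yA + (1 / 2 : ℝ) • yQ, hSA, hSQ, ?_, fun hQ => ?_, fun hQ => ?_⟩
  · refine ((hJR.add hyA).add (hyQ.const_smul (1 / 2 : ℝ))).congr_fun fun s => ?_
    rw [hQj]
    simp only [taylorRemainder, jump]
    abel
  · rw [← e]
    exact weakTendsto_iff.2 fun φ => tendsto_leftRiemannSum hAX hC hleft hX hA hca hcB ht hzA hzQ
      hlimR φ fun T s => weakTendsto_iff.1 (hQ.tendsto s) T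
  · rw [← e]
    exact tendsto_leftRiemannSum hAX hC hleft hX hA hca hcB ht hzA hzQ
      hlimR (ContinuousLinearMap.id ℝ G) fun T s => (T.continuous.tendsto _).comp (hQ.tendsto s)

end Ito

end ItoFollmer

theorem mainTheorem1 {E E₁ F G : Type*}
    [NormedAddCommGroup E] [NormedSpace ℝ E] [CompleteSpace E]
    [NormedAddCommGroup E₁] [NormedSpace ℝ E₁] [CompleteSpace E₁]
    [NormedAddCommGroup F] [NormedSpace ℝ F] [CompleteSpace F]
    [NormedAddCommGroup G] [NormedSpace ℝ G] [CompleteSpace G]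
    (B : E →L[ℝ] E →L[ℝ] E₁)
    (A : ℝ≥0 → F) (X : ℝ≥0 → E)
    (hAX : ItoFollmer.IsCadlag fun t => (A t, X t))
    (π : ℕ → ItoFollmer.HalfLinePartition)
    (hC : ItoFollmer.ConditionC (fun t => (A t, X t)) π)
    (hleft : ItoFollmer.ApproximatesFromLeft π fun t => (A t, X t))
    (Q : ℝ≥0 → E₁) (hQ : ItoFollmer.HasWeakQuadVar B X π Q)
    (hX : ItoFollmer.HasFiniteTwoVariation X π)
    (hA : LocallyBoundedVariationOn A univ)
    (f : F × E → G)
    (Daf : F × E → F →L[ℝ] G)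
    (hDaf : ∀ a x, ItoFollmer.HasGateauxDerivAt (fun a' => f (a', x)) (Daf (a, x)) a)
    (hDaf_cont : ItoFollmer.LcContinuous Daf)
    (Dxf : F × E → E →L[ℝ] G)
    (hDxf : ∀ a x, ItoFollmer.HasGateauxDerivAt (fun x' => f (a, x')) (Dxf (a, x)) x)
    (D2xf : F × E → E →L[ℝ] E →L[ℝ] G)
    (hD2xf : ∀ a x, ItoFollmer.HasGateauxDerivAt (fun x' => Dxf (a, x')) (D2xf (a, x)) x)
    (hDxf_cont : ItoFollmer.LcContinuous Dxf)
    (DBf : F × E → E₁ →L[ℝ] G)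
    (hDBf : ∀ z h k, D2xf z h k = DBf z (B h k))
    (hDBf_cont : ItoFollmer.LcContinuous DBf) :
    ∃ I : ℝ≥0 → G,
      (∀ t, ItoFollmer.HasWeakItoFollmerIntegral (fun s => Dxf (A s, X s)) X π t (I t)) ∧
      (∀ t, ∃ SA SQ J : G,
        ItoFollmer.HasStieltjesIntegral
          (fun s => Daf (ItoFollmer.leftVal A s, ItoFollmer.leftVal X s))
          (ItoFollmer.contPart A) t SA ∧
        ItoFollmer.HasStieltjesIntegral
          (fun s => DBf (ItoFollmer.leftVal A s, ItoFollmer.leftVal X s))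
          (ItoFollmer.contPart Q) t SQ ∧
        HasSum (fun s : Ioc (0 : ℝ≥0) t =>
          f (A s, X s) - f (ItoFollmer.leftVal A s, ItoFollmer.leftVal X s)
            - Dxf (ItoFollmer.leftVal A s, ItoFollmer.leftVal X s) (ItoFollmer.jump X s)) J ∧
        f (A t, X t) - f (A 0, X 0) = SA + I t + (1 / 2 : ℝ) • SQ + J) ∧
      (ItoFollmer.HasStrongQuadVar B X π Q →
        ∀ t, ItoFollmer.HasItoFollmerIntegral (fun s => Dxf (A s, X s)) X π t (I t)) := by
  have key := ItoFollmer.exists_ito hAX hC hleft hQ.cadlag hQ.finiteVariation hQ.jump_eq hX hA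
    hDaf hDaf_cont.continuous hDxf hD2xf hDxf_cont.continuous hDBf hDBf_cont.continuous
  choose SA SQ J hSA hSQ hJ hweak hstrong using key
  refine ⟨fun t => f (A t, X t) - f (A 0, X 0) - SA t - (1 / 2 : ℝ) • SQ t - J t,
    fun t => hweak t hQ,
    fun t => ⟨SA t, SQ t, J t, hSA t, hSQ t, hJ t, by dsimp only; abel⟩, fun hQs t => hstrong t hQs⟩
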